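/- Let $k$ be a commutative ring and let $(J,J')$ be a cubic norm pair over $k$, that is: $J,J'$ are $k$-modules with a bilinear map $T\colon J\times J'\to k$ (also written $T(a',a):=T(a,a')$), symmetric bilinear maps $\times\colon J\times J\to J'$ and $\times\colon J'\times J'\to J$, quadratic maps $\sharp\colon J\to J'$ and $\sharp\colon J'\to J$ with linearization $\times$, and maps $N\colon J\to k$, $N\colon J'\to k$ such that for all $t\in k$ and $a,b\in J$ $$N(ta)=t^3N(a),\qquad T(a^\sharp,a)=3N(a),\qquad N(a+b)=N(a)+T(a^\sharp,b)+T(b^\sharp,a)+N(b),$$ such that the identities $(a^\sharp)^\sharp=N(a)a$, $N(a^\sharp)=N(a)^2$ and $a\times(a^\sharp\times b')=N(a)b'+T(a,b')a^\sharp$ hold for all $a\in J_R$, $b'\in J'_R$ over all commutative $k$-algebras $R$ (where the maps are extended to $J_R=J\otimes_kR$ and $J'_R=J'\otimes_k R$), and such that all of this also holds with the roles of $J$ and $J'$ interchanged. Let $L_{-2}=kx$ and $L_2=ky$ be free of rank one, let $L_{\pm1}=\{(\lambda,b,b',\mu)_\pm \mid \lambda,\mu\in k,\ b\in J,\ b'\in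 J'\}$, and let $M=\bigoplus_{i\ne0}\mathfrak{gl}(L_i)$. Let $\xi\in M$ act on $L_i$ as multiplication by $i$, and let $\zeta\in M$ be given by $x\mapsto -x$, $(\lambda,b,b',\mu)_-\mapsto(-2\lambda,-b,0,\mu)_-$, $(\lambda,b,b',\mu)_+\mapsto(-\lambda,0,b',2\mu)_+$, $y\mapsto y$. Identify $a\in J$ and $a'\in J'$ with the elements of $M$ that vanish on $L_{\pm2}$ and act on $L_{\pm1}$ by $$a\colon(\lambda,b,b',\mu)_\pm\mapsto(0,\lambda a,a\times b,T(a,b'))_\pm,\qquad a'\colon(\lambda,b,b',\mu)_\pm\mapsto-(T(b,a'),a'\times b',\mu a',0)_\pm .$$ Put $\mathbf d_{a,a'}=[a',a]\in M$, $Z=\langle\mathbf d_{a,a'}\mid a\in J,a'\in J'\rangle+k\zeta+k\xi$, $L_0=J'\oplus Z\oplus J\subseteq M$ and $$L=L(J,J')=L_{-2}\oplus L_{-1}\oplus L_0\oplus L_1\oplus L_2 .$$ Then $L$ is a Lie algebra over $k$ with the following bilinear, alternating bracket: elements of $L_0$ bracket as in $M$ and act on each $L_i$ ($i\neq0$) by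 evaluation; and, for $p=(\lambda,b,b',\mu)$ and $q=(\nu,c,c',\rho)$, $$[x,q_+]=-q_-,\quad [y,p_-]=p_+,\quad [x,y]=\xi,$$ $$[p_-,q_-]=\langle p,q\rangle x,\quad [p_+,q_+]=\langle p,q\rangle y,\quad \langle p,q\rangle=T(b,c')-T(c,b')+\mu\nu-\lambda\rho,$$ $$[p_-,q_+]=(-\lambda c'+b\times c-\nu b')+\bigl((\lambda\rho-T(b,c'))\zeta+(T(c,b')-\mu\nu)(\xi-\zeta)+\mathbf d_{b,c'}+\mathbf d_{c,b'}\bigr)+(-\rho b+b'\times c'-\mu c),$$ and $[L_i,L_j]=0$ whenever $|i+j|>2$. Moreover, let $G_2$ be a root system of type $G_2$ with simple roots $\gamma$ (long) and $\delta$ (short), and let $\omega\colon\mathbb ZG_2\to\mathbb Z^2$ be the homomorphism with $\omega(\gamma)=(-2,-1)$, $\omega(\delta)=(1,0)$. Let $L_{-2,-1}=kx$ and $L_{2,1}=ky$; let $L_{-1,-2},L_{-1,-1},L_{-1,0},L_{-1,1}$ (respectively $L_{1,-1},L_{1,0},L_{1,1},L_{1,2}$) be the four coordinate submodules of $L_{-1}$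 (respectively of $L_1$), in this order; let $L_{0,-1}=J'$, $L_{0,0}=Z$, $L_{0,1}=J$; and let $L_{i,j}=0$ otherwise. Then the submodules $L_\alpha:=L_{\omega(\alpha)}$ form a $G_2$-grading of $L$: $L=\bigoplus_{\alpha\in\mathbb ZG_2}L_\alpha$, $[L_\alpha,L_\beta]\subseteq L_{\alpha+\beta}$ for all $\alpha,\beta\in\mathbb ZG_2$, and $L_\alpha=0$ for $\alpha\notin G_2\cup\{0\}$. As $k$-modules, $L_\alpha\cong k$ for every long root $\alpha$, $L_\beta\cong J$ for the three short roots $\beta$ in the orbit of $\delta$ under the subgroup of the Weyl group generated by the reflections in the long roots, and $L_{\beta'}\cong J'$ for the remaining three short roots $\beta'$. -/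

import Mathlib

open scoped TensorProduct

universe u v w

noncomputable section

namespace G2Lie

/-! ### Scalar extension of bilinear, quadratic and cubic maps -/

section Extension

/-- Scalar extension of a bilinear map: `(r ⊗ m, s ⊗ n) ↦ r s ⊗ B m n`. -/
def bilinExt {k M N P : Type*} [CommRing k] [AddCommGroup M] [Module k M] [AddCommGroup N]
    [Module k N] [AddCommGroup P] [Module k P] (R : Type*) [CommRing R] [Algebra k R]
    (B : M →ₗ[k] N →ₗ[k] P) : R ⊗[k] M →ₗ[R] R ⊗[k] N →ₗ[R] R ⊗[k] P :=
  ((LinearMap.baseChangeHom k R N P) ∘ₗ B).liftBaseChange R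

@[simp]
theorem bilinExt_tmul {k M N P : Type*} [CommRing k] [AddCommGroup M] [Module k M]
    [AddCommGroup N] [Module k N] [AddCommGroup P] [Module k P] (R : Type*) [CommRing R]
    [Algebra k R] (B : M →ₗ[k] N →ₗ[k] P) (r s : R) (m : M) (n : N) :
    bilinExt R B (r ⊗ₜ m) (s ⊗ₜ n) = (r * s) ⊗ₜ[k] B m n := by
  simp [bilinExt, TensorProduct.smul_tmul']

/-- A normalized symmetric `2`-cocycle on `A` with values in `B`. -/
structure SymmCocycle (A B : Type*) [AddCommGroup A] [AddCommGroup B] where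
  toFun : A → A → B
  symm : ∀ x y, toFun x y = toFun y x
  zero_right : ∀ x, toFun x 0 = 0
  assoc : ∀ x y z, toFun x y + toFun (x + y) z = toFun y z + toFun x (y + z)

/-- The commutative extension of `A` by `B` which is defined by a symmetric cocycle. -/
@[ext]
structure CocycleExt {A B : Type*} [AddCommGroup A] [AddCommGroup B] (c : SymmCocycle A B) where
  fst : A
  snd : B

instance CocycleExt.instAdd {A B : Type*} [AddCommGroup A] [AddCommGroup B]
    (c : SymmCocycle A B) : Add (CocycleExt c) :=
  ⟨fun x y => ⟨x.fst + y.fst, x.snd + y.snd + c.toFun x.fst y.fst⟩⟩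

instance CocycleExt.instZero {A B : Type*} [AddCommGroup A] [AddCommGroup B]
    (c : SymmCocycle A B) : Zero (CocycleExt c) :=
  ⟨⟨0, 0⟩⟩

instance CocycleExt.instAddCommMonoid {A B : Type*} [AddCommGroup A] [AddCommGroup B]
    (c : SymmCocycle A B) : AddCommMonoid (CocycleExt c) where
  add_assoc x y z := CocycleExt.ext (add_assoc x.fst y.fst z.fst) (by
    have h := c.assoc x.fst y.fst z.fst
    change x.snd + y.snd + c.toFun x.fst y.fst + z.snd + c.toFun (x.fst + y.fst) z.fst
      = x.snd + (y.snd + z.snd + c.toFun y.fst z.fst) + c.toFun x.fst (y.fst + z.fst)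
    calc _ = x.snd + y.snd + z.snd + (c.toFun x.fst y.fst + c.toFun (x.fst + y.fst) z.fst) := by
          abel
      _ = _ := by rw [h]; abel)
  zero_add x := CocycleExt.ext (zero_add x.fst) (by
    change 0 + x.snd + c.toFun 0 x.fst = x.snd
    rw [c.symm, c.zero_right]; abel)
  add_zero x := CocycleExt.ext (add_zero x.fst) (by
    change x.snd + 0 + c.toFun x.fst 0 = x.snd
    rw [c.zero_right]; abel)
  add_comm x y := CocycleExt.ext (add_comm x.fst y.fst) (by
    change x.snd + y.snd + c.toFun x.fst y.fst = y.snd + x.snd + c.toFun y.fst x.fst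
    rw [c.symm]; abel)
  nsmul := nsmulRec

/-- Given a symmetric cocycle `c` on `R ⊗ M`, a function on pure tensors which is additive up to
`c` in each argument and `k`-balanced extends to a function `F` on `R ⊗ M` such that
`F (x + y) = F x + F y + c x y`. -/
theorem exists_extend {k M R B : Type*} [CommRing k] [AddCommGroup M] [Module k M] [CommRing R]
    [Algebra k R] [AddCommGroup B] (c : SymmCocycle (R ⊗[k] M) B) (φ : R → M → B)
    (h₀ : ∀ r, φ r 0 = 0) (h₀' : ∀ m, φ 0 m = 0)
    (h₁ : ∀ r m n, φ r (m + n) = φ r m + φ r n + c.toFun (r ⊗ₜ m) (r ⊗ₜ n))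
    (h₂ : ∀ r s m, φ (r + s) m = φ r m + φ s m + c.toFun (r ⊗ₜ m) (s ⊗ₜ m))
    (h₃ : ∀ (t : k) r m, φ (t • r) m = φ r (t • m)) :
    ∃ F : R ⊗[k] M → B, (∀ r m, F (r ⊗ₜ m) = φ r m) ∧
      ∀ x y, F (x + y) = F x + F y + c.toFun x y := by
  let f : R →+ M →+ CocycleExt c :=
    { toFun := fun r =>
        { toFun := fun m => ⟨r ⊗ₜ m, φ r m⟩
          map_zero' := CocycleExt.ext (TensorProduct.tmul_zero _ _) (h₀ r)
          map_add' := fun m n => CocycleExt.ext (TensorProduct.tmul_add _ _ _) (h₁ r m n) }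
      map_zero' := AddMonoidHom.ext fun m =>
        CocycleExt.ext (TensorProduct.zero_tmul _ _) (h₀' m)
      map_add' := fun r s => AddMonoidHom.ext fun m =>
        CocycleExt.ext (TensorProduct.add_tmul _ _ _) (h₂ r s m) }
  let F := TensorProduct.liftAddHom (R := k) f fun t r m =>
    CocycleExt.ext (TensorProduct.smul_tmul t r m) (h₃ t r m)
  have hfst : ∀ x, (F x).fst = x := by
    intro x
    induction x with
    | zero => rw [map_zero]; rfl
    | tmul r m => rfl
    | add x y hx hy =>
      rw [map_add]
      change (F x).fst + (F y).fst = _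
      rw [hx, hy]
  refine ⟨fun x => (F x).snd, fun r m => rfl, fun x y => ?_⟩
  change (F (x + y)).snd = _
  rw [map_add]
  change (F x).snd + (F y).snd + c.toFun (F x).fst (F y).fst = _
  rw [hfst, hfst]

section Quad

variable {k M N : Type*} [CommRing k] [AddCommGroup M] [Module k M] [AddCommGroup N] [Module k N]

theorem bilinExt_symm (R : Type*) [CommRing R] [Algebra k R] (B : M →ₗ[k] M →ₗ[k] N)
    (hB : ∀ x y, B x y = B y x) (x y : R ⊗[k] M) : bilinExt R B x y = bilinExt R B y x := by
  induction x with
  | zero => simp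
  | add x x' hx hx' => simp [hx, hx']
  | tmul r m =>
    induction y with
    | zero => simp
    | add y y' hy hy' => simp [hy, hy']
    | tmul s n => simp [mul_comm r s, hB m n]

theorem exists_quadExt (R : Type*) [CommRing R] [Algebra k R] (Q : QuadraticMap k M N) :
    ∃ q : QuadraticMap R (R ⊗[k] M) (R ⊗[k] N),
      ∀ r m, q (r ⊗ₜ m) = (r * r) ⊗ₜ[k] Q m := by
  have hs : ∀ x y, Q.polarBilin x y = Q.polarBilin y x := fun x y =>
    QuadraticMap.polar_comm Q x y
  let c : SymmCocycle (R ⊗[k] M) (R ⊗[k] N) :=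
    { toFun := fun x y => bilinExt R Q.polarBilin x y
      symm := bilinExt_symm R _ hs
      zero_right := fun x => map_zero _
      assoc := fun x y z => by simp only [map_add, LinearMap.add_apply]; abel }
  obtain ⟨F, hF, hF'⟩ := exists_extend (k := k) (M := M) (R := R) c
    (fun r m => (r * r) ⊗ₜ[k] Q m) (by simp) (by simp)
    (fun r m n => by
      simp only [c, bilinExt_tmul, QuadraticMap.polarBilin_apply_apply]
      rw [← TensorProduct.tmul_add, ← TensorProduct.tmul_add, ← QuadraticMap.map_add Q])
    (fun r s m => by
      simp only [c, bilinExt_tmul, QuadraticMap.polarBilin_apply_apply, QuadraticMap.polar_self,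
        two_smul, TensorProduct.tmul_add]
      rw [← TensorProduct.add_tmul, ← TensorProduct.add_tmul, ← TensorProduct.add_tmul]
      congr 1; ring)
    (fun t r m => by
      rw [QuadraticMap.map_smul, TensorProduct.tmul_smul, TensorProduct.smul_tmul']
      congr 1; rw [smul_mul_smul_comm])
  have h0 : F 0 = 0 := by simpa using hF 0 0
  refine ⟨⟨F, fun a x => ?_, bilinExt R Q.polarBilin, hF'⟩, hF⟩
  induction x with
  | zero => simp [h0]
  | tmul r m =>
    rw [TensorProduct.smul_tmul', hF, hF, TensorProduct.smul_tmul']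
    congr 1; simp only [smul_eq_mul]; ring
  | add x y hx hy =>
    rw [smul_add, hF', hF', hx, hy]
    simp only [c, map_smul, LinearMap.smul_apply, smul_add, smul_smul]

/-- The scalar extension of a quadratic map: the unique `R`-quadratic map on `R ⊗ M` that maps
`1 ⊗ m` to `1 ⊗ Q m`. -/
def quadExt (R : Type*) [CommRing R] [Algebra k R] (Q : QuadraticMap k M N) :
    QuadraticMap R (R ⊗[k] M) (R ⊗[k] N) :=
  (exists_quadExt R Q).choose

@[simp]
theorem quadExt_tmul (R : Type*) [CommRing R] [Algebra k R] (Q : QuadraticMap k M N) (r : R)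
    (m : M) : quadExt R Q (r ⊗ₜ m) = (r * r) ⊗ₜ[k] Q m :=
  (exists_quadExt R Q).choose_spec r m

end Quad

/-- A cubic map `(f, g)`: `f` is homogeneous of degree `3` and `g x y` is its `(2,1)`-linearization,
quadratic in `x` and linear in `y`. -/
structure CubicMap (k M N : Type*) [CommRing k] [AddCommGroup M] [Module k M] [AddCommGroup N]
    [Module k N] where
  f : M → N
  g : QuadraticMap k M (M →ₗ[k] N)
  f_smul : ∀ (t : k) (x : M), f (t • x) = t ^ 3 • f x
  f_add : ∀ x y : M, f (x + y) = f x + g x y + g y x + f y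
  euler : ∀ x : M, g x x = (3 : k) • f x

section Cubic

variable {k M N : Type*} [CommRing k] [AddCommGroup M] [Module k M] [AddCommGroup N] [Module k N]

/-- The scalar extension of a quadratic map `M → Hom(M, N)`, regarded as a quadratic map
`R ⊗ M → Hom(R ⊗ M, R ⊗ N)`. -/
def quadHomExt (R : Type*) [CommRing R] [Algebra k R] (g : QuadraticMap k M (M →ₗ[k] N)) :
    QuadraticMap R (R ⊗[k] M) (R ⊗[k] M →ₗ[R] R ⊗[k] N) :=
  ((LinearMap.baseChangeHom k R M N).liftBaseChange R).compQuadraticMap (quadExt R g)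

@[simp]
theorem quadHomExt_tmul (R : Type*) [CommRing R] [Algebra k R]
    (g : QuadraticMap k M (M →ₗ[k] N)) (r s : R) (m n : M) :
    quadHomExt R g (r ⊗ₜ m) (s ⊗ₜ n) = (r * r * s) ⊗ₜ[k] g m n := by
  simp [quadHomExt, TensorProduct.smul_tmul']

theorem CubicMap.f_zero (F : CubicMap k M N) : F.f 0 = 0 := by
  simpa using F.f_smul 0 0

theorem CubicMap.polar_rotate (F : CubicMap k M N) (x y z : M) :
    QuadraticMap.polar F.g x y z = QuadraticMap.polar F.g y z x := by
  have h₁ := F.f_add (x + y) z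
  have h₂ := F.f_add x (y + z)
  rw [add_assoc x y z, h₂, F.f_add x y, F.f_add y z] at h₁
  rw [QuadraticMap.map_add F.g x y, QuadraticMap.map_add F.g y z] at h₁
  simp only [LinearMap.add_apply, map_add] at h₁
  have h : ∀ a b c : N, a + b = a + c → b = c := fun a b c => add_left_cancel
  apply h (F.f x + F.f y + F.f z + F.g x y + F.g x z + F.g y x + F.g z x + F.g y z + F.g z y)
  refine Eq.trans ?_ (h₁.symm.trans ?_) <;> abel

/-- The polarization of a quadratic map `M → Hom(M, N)`, as a trilinear map. -/
def polarTri (g : QuadraticMap k M (M →ₗ[k] N)) : M →ₗ[k] M →ₗ[k] M →ₗ[k] N :=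
  QuadraticMap.polarBilin g

theorem polarTri_apply (g : QuadraticMap k M (M →ₗ[k] N)) (x y : M) :
    polarTri g x y = QuadraticMap.polar g x y := rfl

theorem polarTri_add (g : QuadraticMap k M (M →ₗ[k] N)) (x y z : M) :
    g (x + y) z = g x z + g y z + polarTri g x y z := by
  rw [QuadraticMap.map_add g x y]; rfl

theorem polarTri_self (g : QuadraticMap k M (M →ₗ[k] N)) (x y : M) :
    polarTri g x x y = (2 : k) • g x y := by
  rw [polarTri_apply, QuadraticMap.polar_self, two_smul, two_smul]; rfl

theorem quadHomExt_polar_tmul (R : Type*) [CommRing R] [Algebra k R]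
    (g : QuadraticMap k M (M →ₗ[k] N)) (r s t : R) (a b c : M) :
    polarTri (quadHomExt R g) (r ⊗ₜ a) (s ⊗ₜ b) (t ⊗ₜ c)
      = (r * s * t) ⊗ₜ[k] QuadraticMap.polar g a b c := by
  have e : ∀ (r : R) (a : M), r ⊗ₜ[k] a = r • ((1 : R) ⊗ₜ[k] a) := fun r a => by
    simp [TensorProduct.smul_tmul']
  have e' : ∀ (r : R) (a : N), r ⊗ₜ[k] a = r • ((1 : R) ⊗ₜ[k] a) := fun r a => by
    simp [TensorProduct.smul_tmul']
  rw [e r a, e s b, e t c, e' (r * s * t)]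
  simp only [map_smul, LinearMap.smul_apply, smul_smul]
  rw [show t * (s * r) = r * s * t by ring]
  congr 1
  rw [polarTri_apply, QuadraticMap.polar, ← TensorProduct.tmul_add]
  simp only [LinearMap.sub_apply, quadHomExt_tmul, mul_one, ← TensorProduct.tmul_sub]
  rfl

theorem CubicMap.ext_polar_rotate (R : Type*) [CommRing R] [Algebra k R] (F : CubicMap k M N)
    (x y z : R ⊗[k] M) :
    polarTri (quadHomExt R F.g) x y z = polarTri (quadHomExt R F.g) y z x := by
  induction x with
  | zero => simp
  | add x x' hx hx' => simp only [map_add, LinearMap.add_apply, hx, hx']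
  | tmul r a =>
    induction y with
    | zero => simp
    | add y y' hy hy' => simp only [map_add, LinearMap.add_apply, hy, hy']
    | tmul s b =>
      induction z with
      | zero => simp
      | add z z' hz hz' => simp only [map_add, LinearMap.add_apply, hz, hz']
      | tmul t c =>
        rw [quadHomExt_polar_tmul, quadHomExt_polar_tmul, F.polar_rotate]
        congr 1; ring

theorem exists_cubicExt (R : Type*) [CommRing R] [Algebra k R] (F : CubicMap k M N) :
    ∃ E : CubicMap R (R ⊗[k] M) (R ⊗[k] N), E.g = quadHomExt R F.g ∧
      ∀ r m, E.f (r ⊗ₜ m) = (r ^ 3) ⊗ₜ[k] F.f m := by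
  set G := quadHomExt R F.g with hG
  have hadd : ∀ x y z, G (x + y) z = G x z + G y z + polarTri G x y z := polarTri_add G
  let c : SymmCocycle (R ⊗[k] M) (R ⊗[k] N) :=
    { toFun := fun x y => G x y + G y x
      symm := fun x y => add_comm _ _
      zero_right := fun x => by simp
      assoc := fun x y z => by
        have h := F.ext_polar_rotate R x y z
        rw [← hG] at h
        simp only [hadd, map_add, h]
        abel }
  obtain ⟨f, hf, hf'⟩ := exists_extend (k := k) (M := M) (R := R) c
    (fun r m => (r ^ 3) ⊗ₜ[k] F.f m) (by simp [F.f_zero]) (by simp)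
    (fun r m n => by
      simp only [c, hG, quadHomExt_tmul, F.f_add, TensorProduct.tmul_add]
      rw [show r ^ 3 = r * r * r by ring]
      abel)
    (fun r s m => by
      simp only [c, hG, quadHomExt_tmul, F.euler, TensorProduct.tmul_smul,
        TensorProduct.smul_tmul']
      rw [← TensorProduct.add_tmul, ← TensorProduct.add_tmul, ← TensorProduct.add_tmul]
      congr 1
      simp only [Algebra.smul_def, map_ofNat]
      ring)
    (fun t r m => by
      rw [F.f_smul, TensorProduct.tmul_smul, TensorProduct.smul_tmul', smul_pow])
  have h0 : f 0 = 0 := by simpa [F.f_zero] using hf 0 0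
  have he : ∀ x, G x x = (3 : R) • f x := by
    intro x
    induction x with
    | zero => simp [h0]
    | tmul r m =>
      rw [hf, hG, quadHomExt_tmul, F.euler, TensorProduct.tmul_smul, TensorProduct.smul_tmul',
        TensorProduct.smul_tmul']
      congr 1
      simp only [Algebra.smul_def, map_ofNat]
      ring
    | add x y hx hy =>
      rw [hf', smul_add, smul_add, ← hx, ← hy, map_add, hadd, hadd]
      have p₁ : polarTri G x y x = (2 : R) • G x y := by
        rw [hG, F.ext_polar_rotate R x y x, F.ext_polar_rotate R y x x, polarTri_self]
      have p₂ : polarTri G x y y = (2 : R) • G y x := by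
        rw [hG, F.ext_polar_rotate R x y y, polarTri_self]
      rw [p₁, p₂]
      simp only [c]
      module
  refine ⟨⟨f, G, fun t x => ?_, fun x y => by rw [hf']; simp only [c]; abel, he⟩, rfl, hf⟩
  induction x with
  | zero => simp [h0]
  | tmul r m =>
    rw [TensorProduct.smul_tmul', hf, hf, TensorProduct.smul_tmul', smul_eq_mul, smul_eq_mul,
      mul_pow]
  | add x y hx hy =>
    rw [smul_add, hf', hf', hx, hy]
    simp only [c, QuadraticMap.map_smul, map_smul, LinearMap.smul_apply, smul_add, smul_smul]
    congr 3 <;> ring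

/-- The scalar extension of a cubic map: the unique `R`-cubic map on `R ⊗ M` that restricts to the
given one on elements of the form `1 ⊗ m`. -/
def cubicExt (R : Type*) [CommRing R] [Algebra k R] (F : CubicMap k M N) :
    CubicMap R (R ⊗[k] M) (R ⊗[k] N) :=
  (exists_cubicExt R F).choose

theorem cubicExt_g (R : Type*) [CommRing R] [Algebra k R] (F : CubicMap k M N) :
    (cubicExt R F).g = quadHomExt R F.g :=
  (exists_cubicExt R F).choose_spec.1

@[simp]
theorem cubicExt_f_tmul (R : Type*) [CommRing R] [Algebra k R] (F : CubicMap k M N) (r : R)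
    (m : M) : (cubicExt R F).f (r ⊗ₜ m) = (r ^ 3) ⊗ₜ[k] F.f m :=
  (exists_cubicExt R F).choose_spec.2 r m

end Cubic

end Extension

/-! ### Cubic norm pairs -/

/-- The structural maps of a cubic norm pair `(J, J')`; the map `T' : J' × J → k` is the flip of
`T`. The norms come with their `(2,1)`-linearizations. -/
structure CubicNormData (k : Type u) (J : Type v) (J' : Type w) [CommRing k] [AddCommGroup J]
    [Module k J] [AddCommGroup J'] [Module k J'] where
  cross : J →ₗ[k] J →ₗ[k] J'
  cross' : J' →ₗ[k] J' →ₗ[k] J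
  T : J →ₗ[k] J' →ₗ[k] k
  N : CubicMap k J k
  N' : CubicMap k J' k
  sharp : QuadraticMap k J J'
  sharp' : QuadraticMap k J' J

namespace CubicNormData

variable {k : Type u} {J : Type v} {J' : Type w} [CommRing k] [AddCommGroup J] [Module k J]
  [AddCommGroup J'] [Module k J']

/-- Interchange the roles of `J` and `J'`. -/
def swap (D : CubicNormData k J J') : CubicNormData k J' J where
  cross := D.cross'
  cross' := D.cross
  T := D.T.flip
  N := D.N'
  N' := D.N
  sharp := D.sharp'
  sharp' := D.sharp

/-- The norm `N_R : R ⊗ J → R`, where `R ⊗ k` is identified with `R`. -/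
def normExt (D : CubicNormData k J J') (R : Type*) [CommRing R] [Algebra k R] (a : R ⊗[k] J) : R :=
  TensorProduct.AlgebraTensorModule.rid k R R ((cubicExt R D.N).f a)

/-- The trace `T_R : (R ⊗ J) × (R ⊗ J') → R`, where `R ⊗ k` is identified with `R`. -/
def traceExt (D : CubicNormData k J J') (R : Type*) [CommRing R] [Algebra k R] (a : R ⊗[k] J)
    (b : R ⊗[k] J') : R :=
  TensorProduct.AlgebraTensorModule.rid k R R (bilinExt R D.T a b)

/-- The axioms of a cubic norm pair, up to interchanging the roles of `J` and `J'`. The last three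
are required strictly, that is, over all commutative `k`-algebras `R`. (It makes no difference to
take `R` in the universe of `k` only, because these are polynomial identities: they hold over all
`k`-algebras once they hold over polynomial rings over `k`.) -/
structure Axioms (D : CubicNormData k J J') : Prop where
  cross_symm : ∀ a b, D.cross a b = D.cross b a
  sharp_add : ∀ a b, D.sharp (a + b) = D.sharp a + D.sharp b + D.cross a b
  norm_g : ∀ a b, D.N.g a b = D.T b (D.sharp a)
  adjoint : ∀ (R : Type u) [CommRing R] [Algebra k R] (a : R ⊗[k] J),
    quadExt R D.sharp' (quadExt R D.sharp a) = D.normExt R a • a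
  norm_sharp : ∀ (R : Type u) [CommRing R] [Algebra k R] (a : R ⊗[k] J),
    D.swap.normExt R (quadExt R D.sharp a) = D.normExt R a ^ 2
  cross_cross : ∀ (R : Type u) [CommRing R] [Algebra k R] (a : R ⊗[k] J) (b : R ⊗[k] J'),
    bilinExt R D.cross a (bilinExt R D.cross' (quadExt R D.sharp a) b)
      = D.normExt R a • b + D.traceExt R a b • quadExt R D.sharp a

end CubicNormData

/-- A cubic norm pair `(J, J')` over `k`. -/
structure CubicNormPair (k : Type u) (J : Type v) (J' : Type w) [CommRing k] [AddCommGroup J]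
    [Module k J] [AddCommGroup J'] [Module k J'] extends CubicNormData k J J' where
  axs : toCubicNormData.Axioms
  axs_swap : toCubicNormData.swap.Axioms

/-! ### The Lie algebra -/

section Spaces

variable (k : Type u) (J : Type v) (J' : Type w) [CommRing k] [AddCommGroup J] [Module k J]
  [AddCommGroup J'] [Module k J']

/-- The module of quadruples `(λ, b, b', μ)`, underlying both `L₋₁` and `L₁`. -/
abbrev Quad : Type max u v w := k × J × J' × k

/-- `M = gl(L₋₂) ⊕ gl(L₋₁) ⊕ gl(L₁) ⊕ gl(L₂)`, where `L₋₂ = k x` and `L₂ = k y`. -/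
abbrev GlSum : Type max u v w :=
  Module.End k k × Module.End k (Quad k J J') × Module.End k (Quad k J J') × Module.End k k

/-- `L₋₂ ⊕ L₋₁ ⊕ M ⊕ L₁ ⊕ L₂`. The tuple `(α, p, φ, q, β)` stands for
`α x + p₋ + φ + q₊ + β y`. -/
abbrev Ambient : Type max u v w := k × Quad k J J' × GlSum k J J' × Quad k J J' × k

/-- The element `ξ` of `M`, which acts as multiplication by `i` on `L_i`. -/
def xi : GlSum k J J' := (-2, -1, 1, 2)

/-- The element `ζ` of `M`: it maps `x ↦ -x`, `(λ, b, b', μ)₋ ↦ (-2λ, -b, 0, μ)₋`,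
`(λ, b, b', μ)₊ ↦ (-λ, 0, b', 2μ)₊` and `y ↦ y`. -/
def zeta : GlSum k J J' :=
  (-1,
    LinearMap.prodMap (-2) (LinearMap.prodMap (-1) (LinearMap.prodMap 0 1)),
    LinearMap.prodMap (-1) (LinearMap.prodMap 0 (LinearMap.prodMap 1 2)),
    1)

/-- The inclusion of `L₋₂`. -/
def inNegTwo : k →ₗ[k] Ambient k J J' := LinearMap.inl k _ _

/-- The inclusion of `L₋₁`. -/
def inNegOne : Quad k J J' →ₗ[k] Ambient k J J' := LinearMap.inr k _ _ ∘ₗ LinearMap.inl k _ _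

/-- The inclusion of `M`. -/
def inZero : GlSum k J J' →ₗ[k] Ambient k J J' :=
  LinearMap.inr k _ _ ∘ₗ LinearMap.inr k _ _ ∘ₗ LinearMap.inl k _ _

/-- The inclusion of `L₁`. -/
def inOne : Quad k J J' →ₗ[k] Ambient k J J' :=
  LinearMap.inr k _ _ ∘ₗ LinearMap.inr k _ _ ∘ₗ LinearMap.inr k _ _ ∘ₗ LinearMap.inl k _ _

/-- The inclusion of `L₂`. -/
def inTwo : k →ₗ[k] Ambient k J J' :=
  LinearMap.inr k _ _ ∘ₗ LinearMap.inr k _ _ ∘ₗ LinearMap.inr k _ _ ∘ₗ LinearMap.inr k _ _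

/-- The inclusion `λ ↦ (λ, 0, 0, 0)`. -/
def quad₁ : k →ₗ[k] Quad k J J' := LinearMap.inl k _ _

/-- The inclusion `b ↦ (0, b, 0, 0)`. -/
def quad₂ : J →ₗ[k] Quad k J J' := LinearMap.inr k _ _ ∘ₗ LinearMap.inl k _ _

/-- The inclusion `b' ↦ (0, 0, b', 0)`. -/
def quad₃ : J' →ₗ[k] Quad k J J' :=
  LinearMap.inr k _ _ ∘ₗ LinearMap.inr k _ _ ∘ₗ LinearMap.inl k _ _

/-- The inclusion `μ ↦ (0, 0, 0, μ)`. -/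
def quad₄ : k →ₗ[k] Quad k J J' :=
  LinearMap.inr k _ _ ∘ₗ LinearMap.inr k _ _ ∘ₗ LinearMap.inr k _ _

end Spaces

namespace CubicNormPair

variable {k : Type u} {J : Type v} {J' : Type w} [CommRing k] [AddCommGroup J] [Module k J]
  [AddCommGroup J'] [Module k J'] (C : CubicNormPair k J J')

/-- The action of `J` on `L₋₁` and on `L₁`: `[a, (λ, b, b', μ)] = (0, λ a, a × b, T(a, b'))`. -/
def act : J →ₗ[k] Module.End k (Quad k J J') :=
  LinearMap.mk₂ k (fun a z => (0, z.1 • a, C.cross a z.2.1, C.T a z.2.2.1))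
    (fun a₁ a₂ z => by simp)
    (fun t a z => by simp [smul_comm t z.1])
    (fun a z₁ z₂ => by simp [add_smul])
    (fun t a z => by simp [mul_smul])

/-- The action of `J'` on `L₋₁` and on `L₁`:
`[a', (λ, b, b', μ)] = -(T(b, a'), a' × b', μ a', 0)`. -/
def act' : J' →ₗ[k] Module.End k (Quad k J J') :=
  LinearMap.mk₂ k (fun a' z => -(C.T z.2.1 a', C.cross' a' z.2.2.1, z.2.2.2 • a', 0))
    (fun a₁ a₂ z => by simp [add_comm])
    (fun t a z => by simp [smul_comm t z.2.2.2])
    (fun a z₁ z₂ => by simp [add_smul, add_comm])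
    (fun t a z => by simp [mul_smul])

/-- The embedding `a ↦ ad_a` of `J` into `M`. -/
def ad : J →ₗ[k] GlSum k J J' :=
  LinearMap.prod 0 (LinearMap.prod C.act (LinearMap.prod C.act 0))

/-- The embedding `a' ↦ ad_{a'}` of `J'` into `M`. -/
def ad' : J' →ₗ[k] GlSum k J J' :=
  LinearMap.prod 0 (LinearMap.prod C.act' (LinearMap.prod C.act' 0))

/-- `𝐝_{a,a'} = [ad_{a'}, ad_a]`, a commutator in `M`. -/
def d (a : J) (a' : J') : GlSum k J J' := C.ad' a' * C.ad a - C.ad a * C.ad' a'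

/-- `Z = ⟨𝐝_{a,a'} | a ∈ J, a' ∈ J'⟩ + k ζ + k ξ`. -/
def Z : Submodule k (GlSum k J J') :=
  Submodule.span k (Set.range fun p : J × J' => C.d p.1 p.2) ⊔
    Submodule.span k {zeta k J J'} ⊔ Submodule.span k {xi k J J'}

/-- `L₀ = J' ⊕ Z ⊕ J`, a submodule of `M`. -/
def L₀ : Submodule k (GlSum k J J') := LinearMap.range C.ad' ⊔ C.Z ⊔ LinearMap.range C.ad

/-- The module `L(J, J') = L₋₂ ⊕ L₋₁ ⊕ L₀ ⊕ L₁ ⊕ L₂`. -/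
def lieModule : Submodule k (Ambient k J J') :=
  Submodule.prod ⊤ (Submodule.prod ⊤ (Submodule.prod C.L₀ (Submodule.prod ⊤ ⊤)))

/-- The alternating form
`⟨(λ, b, b', μ), (ν, c, c', ρ)⟩ = T(b, c') - T(c, b') + μ ν - λ ρ` which describes the brackets
`L₋₁ × L₋₁ → k x` and `L₁ × L₁ → k y`. -/
def form : Quad k J J' → Quad k J J' → k
  | (l, b, b', m), (n, c, c', r) => C.T b c' - C.T c b' + m * n - l * r

/-- The bracket `[(λ, b, b', μ)₋, (ν, c, c', ρ)₊]`. -/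
def middle : Quad k J J' → Quad k J J' → GlSum k J J'
  | (l, b, b', m), (n, c, c', r) =>
    C.ad' (-(l • c') + C.cross b c - n • b') +
      ((l * r - C.T b c') • zeta k J J' + (C.T c b' - m * n) • (xi k J J' - zeta k J J') +
        C.d b c' + C.d c b') +
      C.ad (-(r • b) + C.cross' b' c' - m • c)

/-- The bracket, given by the following rules, by bilinearity and by antisymmetry: elements of `M`
have their commutator in `M` as bracket and act on each `L_i` by evaluation;
`[x, q₊] = -q₋`, `[y, p₋] = p₊`, `[x, y] = ξ`; the brackets on `L₋₁ × L₋₁`, on `L₁ × L₁` and on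
`L₋₁ × L₁` are given by `form` and `middle`; all other brackets vanish. -/
def bracket : Ambient k J J' → Ambient k J J' → Ambient k J J'
  | (α₁, p₁, φ₁, q₁, β₁), (α₂, p₂, φ₂, q₂, β₂) =>
    ( φ₁.1 α₂ - φ₂.1 α₁ + C.form p₁ p₂,
      φ₁.2.1 p₂ - φ₂.2.1 p₁ - α₁ • q₂ + α₂ • q₁,
      φ₁ * φ₂ - φ₂ * φ₁ + C.middle p₁ q₂ - C.middle p₂ q₁ + (α₁ * β₂ - α₂ * β₁) • xi k J J',
      φ₁.2.2.1 q₂ - φ₂.2.2.1 q₁ + β₁ • p₂ - β₂ • p₁,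
      φ₁.2.2.2 β₂ - φ₂.2.2.2 β₁ + C.form q₁ q₂ )

/-- The submodules `L_{i,j}` for `(i, j) ∈ ℤ²`. -/
def piece : ℤ × ℤ → Submodule k (Ambient k J J')
  | (-2, -1) => LinearMap.range (inNegTwo k J J')
  | (-1, -2) => LinearMap.range (inNegOne k J J' ∘ₗ quad₁ k J J')
  | (-1, -1) => LinearMap.range (inNegOne k J J' ∘ₗ quad₂ k J J')
  | (-1, 0) => LinearMap.range (inNegOne k J J' ∘ₗ quad₃ k J J')
  | (-1, 1) => LinearMap.range (inNegOne k J J' ∘ₗ quad₄ k J J')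
  | (0, -1) => LinearMap.range (inZero k J J' ∘ₗ C.ad')
  | (0, 0) => C.Z.map (inZero k J J')
  | (0, 1) => LinearMap.range (inZero k J J' ∘ₗ C.ad)
  | (1, -1) => LinearMap.range (inOne k J J' ∘ₗ quad₁ k J J')
  | (1, 0) => LinearMap.range (inOne k J J' ∘ₗ quad₂ k J J')
  | (1, 1) => LinearMap.range (inOne k J J' ∘ₗ quad₃ k J J')
  | (1, 2) => LinearMap.range (inOne k J J' ∘ₗ quad₄ k J J')
  | (2, 1) => LinearMap.range (inTwo k J J')
  | _ => ⊥

end CubicNormPair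

/-! ### Root gradings -/

/-- A grading of a Lie algebra by an abelian group `A`. -/
structure IsLieGrading {k L A : Type*} [CommRing k] [LieRing L] [LieAlgebra k L] [AddCommGroup A]
    (S : A → Submodule k L) : Prop where
  iSupIndep : iSupIndep S
  iSup_eq_top : ⨆ a, S a = ⊤
  lie_mem : ∀ {a b : A} {x y : L}, x ∈ S a → y ∈ S b → ⁅x, y⁆ ∈ S (a + b)

section Roots

variable {ι V V' : Type*} [AddCommGroup V] [Module ℝ V] [AddCommGroup V'] [Module ℝ V']

/-- A `Φ`-grading of a Lie algebra: a grading by the root lattice that is supported on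
`Φ ∪ {0}`. -/
structure IsRootGrading {k L : Type*} [CommRing k] [LieRing L] [LieAlgebra k L]
    (P : RootPairing ι ℝ V V') (S : P.rootSpan ℤ → Submodule k L) : Prop
    extends IsLieGrading S where
  eq_bot : ∀ a : P.rootSpan ℤ, a ≠ 0 → (∀ i, a ≠ P.rootSpanMem ℤ i) → S a = ⊥

/-- A root is long if its length with respect to the canonical invariant form is maximal. -/
def IsLong [Fintype ι] (P : RootPairing ι ℝ V V') (i : ι) : Prop :=
  ∀ j, P.RootForm (P.root j) (P.root j) ≤ P.RootForm (P.root i) (P.root i)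

/-- The subgroup of the Weyl group, acting on the (indices of) roots, which is generated by the
reflections in the long roots. -/
def longWeyl [Fintype ι] (P : RootPairing ι ℝ V V') : Subgroup (Equiv.Perm ι) :=
  Subgroup.closure {s | ∃ i, IsLong P i ∧ s = P.reflectionPerm i}

end Roots

end G2Lie

end

noncomputable section

namespace G2Lie

/-! ### Computing with scalar extensions of quadratic maps -/

section Linearization

variable {k M N : Type*} [CommRing k] [AddCommGroup M] [Module k M] [AddCommGroup N] [Module k N]

/-! The Jacobi identity for `L` rests on multilinear consequences of the axioms of a cubic norm
pair. Since the axioms hold over every `k`-algebra, they hold over `k[X]`; inserting a polynomial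
combination of elements of `J` and comparing coefficients gives linearizations over `k`, whatever
the characteristic or the size of `k`. Three facts suffice, together with their mirror images: `T(a,
b × c)` is symmetric (`T_cross_rotate`), and the identities for `(a♯)♯` and for `a × (a♯ × b')` hold
in fully linearized form (`cross'_cross_cross`, `cross_cross'_cross`).

In terms of operators on quadruples, they give the commutators of `𝐝_{a,a'}` with `J` and `J'`
(`d_mul_ad`, `d_mul_ad'`) and express the cyclic sum of the `𝐝_{a,b×c}` as a multiple of `2ζ - ξ`
(`d_cross_cyclic`). These relations show that `J`, `J'`, `ζ` and `ξ` act as derivations of all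
brackets between nonzero degrees. Derivations are closed under sums, multiples and commutators, so
every element of `L₀` is one (`isDer_of_mem_L₀`). This settles each instance of the Jacobi identity
with an argument in `L₀`. The remaining instances amount to `middle_neg_apply`, `middle_pos_apply`
and `middle_swap`, which need only the symmetry of `×` and of `T(a, b × c)`. `bracket_leibniz`
assembles everything.

For the grading, the vectors `(-2, -1)` and `(1, 0)` form a basis of `ℤ²`, so `ω` is an isomorphism
and a `ℤ²`-grading suffices. On quadruples, `J` raises the coordinate by one step, `J'` lowers it by
one step and `Z` preserves it; hence the sum `J' + Z + J` is direct, and the inclusions of brackets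
become arithmetic of degrees. On the side of the root system, `ω` maps the twelve roots onto the
twelve nonzero degrees in the support. The coordinate sum modulo `3` vanishes on long roots, so
reflections in long roots preserve it; it separates the two classes of short roots, carrying `J` and
`J'`. -/

theorem quadExt_polarBilin (R : Type*) [CommRing R] [Algebra k R] (Q : QuadraticMap k M N) :
    (quadExt R Q).polarBilin = bilinExt R Q.polarBilin := by
  ext m n
  simp [QuadraticMap.polar, ← TensorProduct.tmul_add, TensorProduct.tmul_sub]

/-- `quadExt` is known only through its values on pure tensors; this rule makes it computable on
sums of them. -/
theorem quadExt_add (R : Type*) [CommRing R] [Algebra k R] (Q : QuadraticMap k M N)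
    (x y : R ⊗[k] M) :
    quadExt R Q (x + y) = quadExt R Q x + quadExt R Q y + bilinExt R Q.polarBilin x y := by
  rw [QuadraticMap.map_add (quadExt R Q), ← quadExt_polarBilin]
  rfl

/-- A quadratic map on `R ⊗ M` is determined by its values on pure tensors. -/
theorem quadraticMap_ext_tmul {R P : Type*} [CommRing R] [Algebra k R] [AddCommGroup P]
    [Module R P] {q₁ q₂ : QuadraticMap R (R ⊗[k] M) P}
    (h : ∀ m : M, q₁ (1 ⊗ₜ m) = q₂ (1 ⊗ₜ m)) : q₁ = q₂ := by
  have hp : q₁.polarBilin = q₂.polarBilin := by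
    have e : ∀ (r : R) (a : M), r ⊗ₜ[k] a = r • ((1 : R) ⊗ₜ[k] a) := fun r a => by
      simp [TensorProduct.smul_tmul']
    refine LinearMap.ext₂ fun x y => ?_
    induction x with
    | zero => simp only [map_zero, LinearMap.zero_apply]
    | add x x' hx hx' => simp only [map_add, LinearMap.add_apply, hx, hx']
    | tmul r m =>
      induction y with
      | zero => simp only [map_zero]
      | add y y' hy hy' => simp only [map_add, hy, hy']
      | tmul s n =>
        rw [e r m, e s n]
        simp only [map_smul, LinearMap.smul_apply, QuadraticMap.polarBilin_apply_apply,
          QuadraticMap.polar, ← TensorProduct.tmul_add, h]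
  ext x
  induction x with
  | zero => simp
  | tmul r m =>
    have e : r ⊗ₜ[k] m = r • ((1 : R) ⊗ₜ[k] m) := by simp [TensorProduct.smul_tmul']
    rw [e, QuadraticMap.map_smul, QuadraticMap.map_smul, h]
  | add x y hx hy =>
    rw [QuadraticMap.map_add q₁, QuadraticMap.map_add q₂, hx, hy]
    congr 1
    exact LinearMap.congr_fun₂ hp x y

/-- Extraction of the `n`-th coefficient of an element of `k[X] ⊗ M`. -/
def coeffTensor (k M : Type*) [CommRing k] [AddCommGroup M] [Module k M] (n : ℕ) :
    Polynomial k ⊗[k] M →ₗ[k] M :=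
  (TensorProduct.lid k M).toLinearMap ∘ₗ (Polynomial.lcoeff k n).rTensor M

@[simp]
theorem coeffTensor_tmul (n : ℕ) (f : Polynomial k) (m : M) :
    coeffTensor k M n (f ⊗ₜ m) = f.coeff n • m := by
  simp [coeffTensor]

end Linearization

/-! ### Linearized identities in a cubic norm pair -/

namespace CubicNormData

variable {k : Type u} {J : Type v} {J' : Type w} [CommRing k] [AddCommGroup J] [Module k J]
  [AddCommGroup J'] [Module k J'] {D : CubicNormData k J J'}

namespace Axioms

theorem polarBilin_sharp (h : D.Axioms) : D.sharp.polarBilin = D.cross := by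
  ext a b
  simp only [QuadraticMap.polarBilin_apply_apply, QuadraticMap.polar, h.sharp_add]
  abel

theorem quadExt_sharp_add (h : D.Axioms) (R : Type*) [CommRing R] [Algebra k R]
    (x y : R ⊗[k] J) :
    quadExt R D.sharp (x + y)
      = quadExt R D.sharp x + quadExt R D.sharp y + bilinExt R D.cross x y := by
  rw [quadExt_add, h.polarBilin_sharp]

/-- Both sides are `R`-quadratic in `x`, so the case `x = 1 ⊗ m` suffices, and there it is `norm_g`.
It is needed to expand the extended norm of a sum. -/
theorem quadHomExt_norm (h : D.Axioms) (R : Type*) [CommRing R] [Algebra k R] (x y : R ⊗[k] J) :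
    quadHomExt R D.N.g x y = bilinExt R D.T y (quadExt R D.sharp x) := by
  have : quadHomExt R D.N.g =
      (bilinExt R D.T).flip.compQuadraticMap (quadExt R D.sharp) := by
    refine quadraticMap_ext_tmul (R := R) (M := J)
      (P := R ⊗[k] J →ₗ[R] R ⊗[k] k) fun m => ?_
    ext n
    simp [h.norm_g]
  rw [this]
  rfl

theorem normExt_add (h : D.Axioms) (R : Type*) [CommRing R] [Algebra k R] (x y : R ⊗[k] J) :
    D.normExt R (x + y) = D.normExt R x + D.traceExt R y (quadExt R D.sharp x)
      + D.traceExt R x (quadExt R D.sharp y) + D.normExt R y := by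
  simp only [normExt, traceExt, CubicMap.f_add, cubicExt_g, h.quadHomExt_norm, map_add]

end Axioms

@[simp]
theorem normExt_tmul (R : Type*) [CommRing R] [Algebra k R] (r : R) (a : J) :
    D.normExt R (r ⊗ₜ a) = D.N.f a • r ^ 3 := by
  simp [normExt]

@[simp]
theorem traceExt_tmul (R : Type*) [CommRing R] [Algebra k R] (r s : R) (a : J) (b : J') :
    D.traceExt R (r ⊗ₜ a) (s ⊗ₜ b) = D.T a b • (r * s) := by
  simp [traceExt]

@[simp]
theorem traceExt_add_left (R : Type*) [CommRing R] [Algebra k R] (x y : R ⊗[k] J)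
    (z : R ⊗[k] J') : D.traceExt R (x + y) z = D.traceExt R x z + D.traceExt R y z := by
  simp [traceExt]

@[simp]
theorem traceExt_add_right (R : Type*) [CommRing R] [Algebra k R] (x : R ⊗[k] J)
    (y z : R ⊗[k] J') : D.traceExt R x (y + z) = D.traceExt R x y + D.traceExt R x z := by
  simp [traceExt]

namespace Axioms

/-- `T(a, b × c)` is invariant under cyclic permutations. -/
theorem T_cross_rotate (h : D.Axioms) (a b c : J) :
    D.T a (D.cross b c) = D.T b (D.cross c a) := by
  -- The trilinear form is the full polarization of the cubic form `N`, and such a polarization is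
  -- invariant under rotation.
  have e : ∀ x y z : J, QuadraticMap.polar D.N.g x y z = D.T z (D.cross x y) := fun x y z => by
    simp only [QuadraticMap.polar, LinearMap.sub_apply, h.norm_g, h.sharp_add, map_add]
    ring
  rw [← e, ← e, D.N.polar_rotate c a b, D.N.polar_rotate a b c]

/-- The part of `(a♯)♯ = N(a) a` which is quadratic in `a` and linear in each of two further
variables. -/
theorem cross'_cross_cross_quadratic (h : D.Axioms) (h' : D.swap.Axioms) (a b c : J) :
    D.cross' (D.cross a b) (D.cross a c) + D.cross' (D.sharp a) (D.cross b c)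
      = D.T b (D.sharp a) • c + D.T c (D.sharp a) • b + D.T a (D.cross b c) • a := by
  -- The identity has total degree `4`. A term with `i` factors `b` and `j` factors `c` contributes
  -- to `X ^ (i + 5 * j)`, and `i + 5 * j = 6` with `i + j ≤ 4` forces `i = j = 1`. So the
  -- coefficient of `X ^ 6` isolates the desired part.
  have H := h.adjoint (Polynomial k)
    (Polynomial.monomial 0 (1 : k) ⊗ₜ[k] a + Polynomial.monomial 1 (1 : k) ⊗ₜ b
      + Polynomial.monomial 5 (1 : k) ⊗ₜ c)
  have H' := congrArg (coeffTensor k J 6) H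
  have e := h'.quadExt_sharp_add (Polynomial k)
  change ∀ x y, quadExt _ D.sharp' (x + y) = quadExt _ D.sharp' x + quadExt _ D.sharp' y +
    bilinExt _ D.cross' x y at e
  simp only [h.quadExt_sharp_add, h.normExt_add, e, map_add, LinearMap.add_apply, quadExt_tmul,
    bilinExt_tmul, normExt_tmul, traceExt_tmul, traceExt_add_left, traceExt_add_right, add_smul,
    smul_add, TensorProduct.smul_tmul', coeffTensor_tmul] at H'
  simp only [smul_eq_mul, Polynomial.monomial_mul_monomial, Polynomial.monomial_pow,
    Polynomial.smul_monomial, Polynomial.coeff_monomial, mul_one, one_pow] at H'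
  norm_num at H'
  rw [H', h.T_cross_rotate c a b]
  abel

/-- The coefficient of `X` in the axiom `cross_cross`, evaluated at `a + X c`. -/
theorem cross_cross'_cross_quadratic (h : D.Axioms) (a c : J) (b : J') :
    D.cross c (D.cross' (D.sharp a) b) + D.cross a (D.cross' (D.cross a c) b)
      = D.T c (D.sharp a) • b + D.T a b • D.cross a c + D.T c b • D.sharp a := by
  have H := h.cross_cross (Polynomial k)
    (Polynomial.monomial 0 (1 : k) ⊗ₜ[k] a + Polynomial.monomial 1 (1 : k) ⊗ₜ c)
    (Polynomial.monomial 0 (1 : k) ⊗ₜ b)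
  have H' := congrArg (coeffTensor k J' 1) H
  simp only [h.quadExt_sharp_add, h.normExt_add, map_add, LinearMap.add_apply, quadExt_tmul,
    bilinExt_tmul, normExt_tmul, traceExt_tmul, traceExt_add_left, add_smul,
    smul_add, TensorProduct.smul_tmul', coeffTensor_tmul] at H'
  simp only [smul_eq_mul, Polynomial.monomial_mul_monomial, Polynomial.monomial_pow,
    Polynomial.smul_monomial, Polynomial.coeff_monomial, mul_one, one_pow] at H'
  norm_num at H'
  rw [H']
  abel

/-- Polarization of the quadratic version in its quadratic variable: its instance at `a + b` minus
those at `a` and at `b`. The rotations of `T` bring all trace coefficients to a common form. -/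
theorem cross'_cross_cross (h : D.Axioms) (h' : D.swap.Axioms) (a b c d : J) :
    D.cross' (D.cross b c) (D.cross a d) + D.cross' (D.cross c a) (D.cross b d)
        + D.cross' (D.cross a b) (D.cross c d)
      = D.T d (D.cross b c) • a + D.T d (D.cross c a) • b + D.T d (D.cross a b) • c
        + D.T a (D.cross b c) • d := by
  have H := h.cross'_cross_cross_quadratic h' (a + b) c d
  simp only [h.sharp_add, map_add, LinearMap.add_apply] at H
  have hs : D.cross' (D.cross a c) (D.cross b d) = D.cross' (D.cross c a) (D.cross b d) := by
    rw [h.cross_symm a c]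
  have ht : D.T b (D.cross c d) = D.T d (D.cross b c) := (h.T_cross_rotate d b c).symm
  have ht' : D.T a (D.cross c d) = D.T d (D.cross c a) := by
    rw [h.cross_symm c a]; exact (h.T_cross_rotate d a c).symm
  have ht₃ : D.T c (D.cross a b) = D.T a (D.cross b c) := h.T_cross_rotate c a b
  have H₁ := h.cross'_cross_cross_quadratic h' a c d
  have H₂ := h.cross'_cross_cross_quadratic h' b c d
  rw [ht'] at H₁
  rw [ht] at H₂
  rw [ht, ht', hs, ht₃] at H
  linear_combination (norm := module) H - H₁ - H₂

theorem cross_cross'_cross (h : D.Axioms) (a b c : J) (x : J') :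
    D.cross a (D.cross' (D.cross b c) x) + D.cross b (D.cross' (D.cross c a) x)
        + D.cross c (D.cross' (D.cross a b) x)
      = D.T a (D.cross b c) • x + D.T a x • D.cross b c + D.T b x • D.cross c a
        + D.T c x • D.cross a b := by
  have H := h.cross_cross'_cross_quadratic (a + b) c x
  have H₁ := h.cross_cross'_cross_quadratic a c x
  have H₂ := h.cross_cross'_cross_quadratic b c x
  have ht₃ : D.T c (D.cross a b) = D.T a (D.cross b c) := h.T_cross_rotate c a b
  simp only [h.sharp_add, map_add, LinearMap.add_apply, ht₃] at H
  simp only [h.cross_symm a c] at H H₁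
  linear_combination (norm := module) H - H₁ - H₂

end Axioms
end CubicNormData

namespace CubicNormPair

variable {k : Type u} {J : Type v} {J' : Type w} [CommRing k] [AddCommGroup J] [Module k J]
  [AddCommGroup J'] [Module k J'] (C : CubicNormPair k J J')

theorem cross_symm (a b : J) : C.cross a b = C.cross b a := C.axs.cross_symm a b

theorem cross'_symm (a b : J') : C.cross' a b = C.cross' b a := C.axs_swap.cross_symm a b

theorem T_cross (a b c : J) : C.T a (C.cross b c) = C.T b (C.cross c a) :=
  C.axs.T_cross_rotate a b c

theorem T_cross' (a b c : J') : C.T (C.cross' b c) a = C.T (C.cross' c a) b :=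
  C.axs_swap.T_cross_rotate a b c

theorem cross_cross'_cross (a b c : J) (x : J') :
    C.cross a (C.cross' (C.cross b c) x) + C.cross b (C.cross' (C.cross c a) x)
        + C.cross c (C.cross' (C.cross a b) x)
      = C.T a (C.cross b c) • x + C.T a x • C.cross b c + C.T b x • C.cross c a
        + C.T c x • C.cross a b :=
  C.axs.cross_cross'_cross a b c x

theorem cross'_cross_cross' (a b c : J') (x : J) :
    C.cross' a (C.cross (C.cross' b c) x) + C.cross' b (C.cross (C.cross' c a) x)
        + C.cross' c (C.cross (C.cross' a b) x)
      = C.T (C.cross' b c) a • x + C.T x a • C.cross' b c + C.T x b • C.cross' c a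
        + C.T x c • C.cross' a b :=
  C.axs_swap.cross_cross'_cross a b c x

theorem cross'_cross_cross (a b c d : J) :
    C.cross' (C.cross b c) (C.cross a d) + C.cross' (C.cross c a) (C.cross b d)
        + C.cross' (C.cross a b) (C.cross c d)
      = C.T d (C.cross b c) • a + C.T d (C.cross c a) • b + C.T d (C.cross a b) • c
        + C.T a (C.cross b c) • d :=
  C.axs.cross'_cross_cross C.axs_swap a b c d

theorem cross_cross'_cross' (a b c d : J') :
    C.cross (C.cross' b c) (C.cross' a d) + C.cross (C.cross' c a) (C.cross' b d)
        + C.cross (C.cross' a b) (C.cross' c d)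
      = C.T (C.cross' b c) d • a + C.T (C.cross' c a) d • b + C.T (C.cross' a b) d • c
        + C.T (C.cross' b c) a • d :=
  C.axs_swap.cross'_cross_cross C.axs a b c d

end CubicNormPair

theorem quad_ext {k J J' : Type*} {p q : k × J × J' × k} (h₁ : p.1 = q.1) (h₂ : p.2.1 = q.2.1)
    (h₃ : p.2.2.1 = q.2.2.1) (h₄ : p.2.2.2 = q.2.2.2) : p = q :=
  Prod.ext h₁ (Prod.ext h₂ (Prod.ext h₃ h₄))

/-! ### The elements of `L₀` as operators and their commutators -/

namespace CubicNormPair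

variable {k : Type u} {J : Type v} {J' : Type w} [CommRing k] [AddCommGroup J] [Module k J]
  [AddCommGroup J'] [Module k J'] (C : CubicNormPair k J J')

theorem T_cross_left_comm (a b c : J) : C.T a (C.cross b c) = C.T b (C.cross a c) := by
  rw [C.T_cross, C.cross_symm]

theorem T_cross'_left_comm (a b c : J') : C.T (C.cross' b c) a = C.T (C.cross' a c) b := by
  rw [C.T_cross', C.cross'_symm]

theorem glSum_ext {φ ψ : GlSum k J J'} (h₁ : φ.1 1 = ψ.1 1) (h₂ : ∀ p, φ.2.1 p = ψ.2.1 p)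
    (h₃ : ∀ p, φ.2.2.1 p = ψ.2.2.1 p) (h₄ : φ.2.2.2 1 = ψ.2.2.2 1) : φ = ψ :=
  Prod.ext (LinearMap.ext_ring h₁) (Prod.ext (LinearMap.ext h₂)
    (Prod.ext (LinearMap.ext h₃) (LinearMap.ext_ring h₄)))

@[simp]
theorem act_apply (a : J) (p : Quad k J J') :
    C.act a p = (0, p.1 • a, C.cross a p.2.1, C.T a p.2.2.1) := rfl

@[simp]
theorem act'_apply (a : J') (p : Quad k J J') :
    C.act' a p = (-C.T p.2.1 a, -C.cross' a p.2.2.1, -(p.2.2.2 • a), 0) := by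
  change -(_, _, _, (0 : k)) = _
  simp

theorem ad_eq (a : J) : C.ad a = (0, C.act a, C.act a, 0) := rfl

theorem ad'_eq (a : J') : C.ad' a = (0, C.act' a, C.act' a, 0) := rfl

/-- The action of `𝐝_{a,a'}` on the quadruples. -/
def dAct (a : J) (a' : J') : Module.End k (Quad k J J') :=
  C.act' a' * C.act a - C.act a * C.act' a'

theorem d_eq (a : J) (a' : J') : C.d a a' = (0, C.dAct a a', C.dAct a a', 0) := by
  simp [d, ad_eq, ad'_eq, dAct]

@[simp]
theorem dAct_apply (a : J) (a' : J') (p : Quad k J J') :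
    C.dAct a a' p = (-(C.T a a' * p.1), C.T p.2.1 a' • a - C.cross' a' (C.cross a p.2.1),
      C.cross a (C.cross' a' p.2.2.1) - C.T a p.2.2.1 • a', C.T a a' * p.2.2.2) := by
  simp [dAct, mul_comm]
  constructor <;> abel

@[simp]
theorem zeta_neg_apply (p : Quad k J J') :
    (zeta k J J').2.1 p = (-2 * p.1, -p.2.1, 0, p.2.2.2) := by
  simp [zeta]

@[simp]
theorem zeta_pos_apply (p : Quad k J J') :
    (zeta k J J').2.2.1 p = (-p.1, 0, p.2.2.1, 2 * p.2.2.2) := by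
  simp [zeta]

@[simp] theorem zeta_negTwo : (zeta k J J').1 = -1 := rfl
@[simp] theorem zeta_two : (zeta k J J').2.2.2 = 1 := rfl
@[simp] theorem xi_negTwo : (xi k J J').1 = -2 := rfl
@[simp] theorem xi_neg : (xi k J J').2.1 = -1 := rfl
@[simp] theorem xi_pos : (xi k J J').2.2.1 = 1 := rfl
@[simp] theorem xi_two : (xi k J J').2.2.2 = 2 := rfl

theorem d_add_left (a b : J) (c : J') : C.d (a + b) c = C.d a c + C.d b c := by
  simp only [d, map_add, mul_add, add_mul]; abel

theorem d_add_right (a : J) (b c : J') : C.d a (b + c) = C.d a b + C.d a c := by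
  simp only [d, map_add, mul_add, add_mul]; abel

theorem d_smul_left (t : k) (a : J) (c : J') : C.d (t • a) c = t • C.d a c := by
  simp only [d, map_smul, mul_smul_comm, smul_mul_assoc, smul_sub]

theorem d_smul_right (t : k) (a : J) (c : J') : C.d a (t • c) = t • C.d a c := by
  simp only [d, map_smul, mul_smul_comm, smul_mul_assoc, smul_sub]

/-- On the `J`-coordinate this is `cross'_cross_cross`, on the `J'`-coordinate `cross_cross'_cross`.
It is the relation that makes `ad a` a derivation of the bracket `L₋₁ × L₁ → L₀`. -/
theorem d_cross_cyclic (a b c : J) :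
    C.d a (C.cross b c) + C.d b (C.cross c a) + C.d c (C.cross a b)
      = C.T a (C.cross b c) • (2 • zeta k J J' - xi k J J') := by
  have hT : C.T b (C.cross c a) = C.T a (C.cross b c) := (C.T_cross a b c).symm
  have hT' : C.T c (C.cross a b) = C.T a (C.cross b c) := C.T_cross c a b
  -- The element `2ζ - ξ` acts with the weights `-3, -1, 1, 3` on both copies of the quadruples and
  -- vanishes on `L_{±2}`, so one computation serves both copies.
  have key : ∀ p : Quad k J J', C.dAct a (C.cross b c) p + C.dAct b (C.cross c a) p
      + C.dAct c (C.cross a b) p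
      = C.T a (C.cross b c) • ((-3 * p.1, -p.2.1, p.2.2.1, 3 * p.2.2.2) : Quad k J J') := by
    intro p
    have h₁ := C.cross'_cross_cross a b c p.2.1
    have h₂ := C.cross_cross'_cross a b c p.2.2.1
    simp only [dAct_apply, hT, hT', Prod.mk_add_mk, Prod.smul_mk, Prod.mk.injEq, smul_eq_mul]
    refine ⟨by ring, ?_, ?_, by ring⟩
    · linear_combination (norm := module) -h₁
    · linear_combination (norm := module) h₂
  refine glSum_ext ?_ (fun p => ?_) (fun p => ?_) ?_
  · simp [d_eq]
  · refine (key p).trans (quad_ext ?_ ?_ ?_ ?_) <;> simp <;> first | ring1 | module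
  · refine (key p).trans (quad_ext ?_ ?_ ?_ ?_) <;> simp <;> first | ring1 | module
  · simp [d_eq]

theorem d_cross'_cyclic (a b c : J') :
    C.d (C.cross' b c) a + C.d (C.cross' c a) b + C.d (C.cross' a b) c
      = C.T (C.cross' b c) a • (2 • zeta k J J' - xi k J J') := by
  have hT : C.T (C.cross' c a) b = C.T (C.cross' b c) a := (C.T_cross' a b c).symm
  have hT' : C.T (C.cross' a b) c = C.T (C.cross' b c) a := C.T_cross' c a b
  have key : ∀ p : Quad k J J', C.dAct (C.cross' b c) a p + C.dAct (C.cross' c a) b p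
      + C.dAct (C.cross' a b) c p
      = C.T (C.cross' b c) a • ((-3 * p.1, -p.2.1, p.2.2.1, 3 * p.2.2.2) : Quad k J J') := by
    intro p
    have h₁ := C.cross'_cross_cross' a b c p.2.1
    have h₂ := C.cross_cross'_cross' a b c p.2.2.1
    simp only [dAct_apply, hT, hT', Prod.mk_add_mk, Prod.smul_mk, Prod.mk.injEq, smul_eq_mul]
    refine ⟨by ring, ?_, ?_, by ring⟩
    · linear_combination (norm := module) -h₁
    · linear_combination (norm := module) h₂
  refine glSum_ext ?_ (fun p => ?_) (fun p => ?_) ?_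
  · simp [d_eq]
  · refine (key p).trans (quad_ext ?_ ?_ ?_ ?_) <;> simp <;> first | ring1 | module
  · refine (key p).trans (quad_ext ?_ ?_ ?_ ?_) <;> simp <;> first | ring1 | module
  · simp [d_eq]

theorem ad_mul_ad (a b : J) : C.ad a * C.ad b - C.ad b * C.ad a = 0 := by
  refine glSum_ext ?_ (fun p => quad_ext ?_ ?_ ?_ ?_) (fun p => quad_ext ?_ ?_ ?_ ?_) ?_ <;>
    simp [ad_eq, C.cross_symm a b, C.T_cross_left_comm a b]

theorem ad'_mul_ad' (a b : J') : C.ad' a * C.ad' b - C.ad' b * C.ad' a = 0 := by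
  refine glSum_ext ?_ (fun p => quad_ext ?_ ?_ ?_ ?_) (fun p => quad_ext ?_ ?_ ?_ ?_) ?_ <;>
    simp [ad'_eq, C.cross'_symm a b, C.T_cross'_left_comm a b]

theorem ad'_mul_ad (a : J) (a' : J') : C.ad' a' * C.ad a - C.ad a * C.ad' a' = C.d a a' := rfl

/-- With respect to `T`, the operators `a' × (a × ·)` on `J` and `a × (a' × ·)` on `J'` are adjoint.
-/
theorem T_cross_cross' (a c : J) (a' b' : J') :
    C.T c (C.cross a (C.cross' a' b')) = C.T (C.cross' a' (C.cross a c)) b' := by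
  rw [C.T_cross c a, C.T_cross a, C.cross_symm c a, C.T_cross' _ a' b', C.T_cross' a' b',
    C.cross'_symm]

theorem End_apply_ring (f : Module.End k k) (t : k) : f t = t * f 1 := by
  rw [← smul_eq_mul, ← map_smul, smul_eq_mul, mul_one]

/-- Only the last two coordinates carry content: the `J'`-coordinate is `cross_cross'_cross`, and
the last one is the adjointness `T_cross_cross'`. -/
theorem d_mul_ad (a c : J) (a' : J') : C.d a a' * C.ad c - C.ad c * C.d a a'
    = C.ad (C.T a a' • c + C.T c a' • a - C.cross' a' (C.cross a c)) := by
  have key : ∀ p : Quad k J J', C.dAct a a' (C.act c p) - C.act c (C.dAct a a' p)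
      = C.act (C.T a a' • c + C.T c a' • a - C.cross' a' (C.cross a c)) p := by
    intro p
    refine quad_ext ?_ ?_ ?_ ?_
    · simp
    · simp
      module
    · have h := C.cross_cross'_cross c p.2.1 a a'
      simp
      simp only [C.cross_symm, C.cross'_symm, C.T_cross_left_comm] at h ⊢
      linear_combination (norm := module) h
    · simp
      linear_combination -C.T_cross_cross' a c a' p.2.2.1
  refine glSum_ext ?_ (fun p => ?_) (fun p => ?_) ?_
  · simp [d_eq, ad_eq]
  · exact key p
  · exact key p
  · simp [d_eq, ad_eq]

theorem d_mul_ad' (a : J) (a' c : J') : C.d a a' * C.ad' c - C.ad' c * C.d a a'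
    = C.ad' (C.cross a (C.cross' a' c) - C.T a a' • c - C.T a c • a') := by
  have key : ∀ p : Quad k J J', C.dAct a a' (C.act' c p) - C.act' c (C.dAct a a' p)
      = C.act' (C.cross a (C.cross' a' c) - C.T a a' • c - C.T a c • a') p := by
    intro p
    refine quad_ext ?_ ?_ ?_ ?_
    · simp
      linear_combination C.T_cross_cross' a p.2.1 a' c
    · have h := C.cross'_cross_cross' c p.2.2.1 a' a
      simp
      simp only [C.cross_symm, C.cross'_symm, C.T_cross'_left_comm] at h ⊢
      linear_combination (norm := module) h
    · simp
      module
    · simp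
  refine glSum_ext ?_ (fun p => ?_) (fun p => ?_) ?_
  · simp [d_eq, ad'_eq]
  · exact key p
  · exact key p
  · simp [d_eq, ad'_eq]

theorem zeta_mul_ad (c : J) : zeta k J J' * C.ad c - C.ad c * zeta k J J' = C.ad c := by
  refine glSum_ext ?_ (fun p => quad_ext ?_ ?_ ?_ ?_) (fun p => quad_ext ?_ ?_ ?_ ?_) ?_ <;>
    simp [ad_eq] <;> first | ring1 | module

theorem zeta_mul_ad' (c : J') : zeta k J J' * C.ad' c - C.ad' c * zeta k J J' = -C.ad' c := by
  refine glSum_ext ?_ (fun p => quad_ext ?_ ?_ ?_ ?_) (fun p => quad_ext ?_ ?_ ?_ ?_) ?_ <;>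
    simp [ad'_eq] <;> first | ring1 | module

theorem zeta_mul_d (a : J) (a' : J') : zeta k J J' * C.d a a' - C.d a a' * zeta k J J' = 0 := by
  refine glSum_ext ?_ (fun p => quad_ext ?_ ?_ ?_ ?_) (fun p => quad_ext ?_ ?_ ?_ ?_) ?_ <;>
    simp [d_eq] <;> first | ring1 | module

/-- `ξ` is a scalar on each summand, and `M` preserves every summand. -/
theorem xi_mul (φ : GlSum k J J') : xi k J J' * φ = φ * xi k J J' := by
  refine glSum_ext ?_ (fun p => ?_) (fun p => ?_) ?_
  · change (-2 : Module.End k k) (φ.1 1) = φ.1 ((-2 : Module.End k k) 1)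
    simp [End_apply_ring φ.1 2]
  · simp
  · simp
  · change (2 : Module.End k k) (φ.2.2.2 1) = φ.2.2.2 ((2 : Module.End k k) 1)
    simp [End_apply_ring φ.2.2.2 2]


@[simp] theorem ad_negTwo (a : J) : (C.ad a).1 = 0 := rfl
@[simp] theorem ad_neg (a : J) : (C.ad a).2.1 = C.act a := rfl
@[simp] theorem ad_pos (a : J) : (C.ad a).2.2.1 = C.act a := rfl
@[simp] theorem ad_two (a : J) : (C.ad a).2.2.2 = 0 := rfl
@[simp] theorem ad'_negTwo (a : J') : (C.ad' a).1 = 0 := rfl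
@[simp] theorem ad'_neg (a : J') : (C.ad' a).2.1 = C.act' a := rfl
@[simp] theorem ad'_pos (a : J') : (C.ad' a).2.2.1 = C.act' a := rfl
@[simp] theorem ad'_two (a : J') : (C.ad' a).2.2.2 = 0 := rfl
@[simp] theorem d_negTwo (a : J) (a' : J') : (C.d a a').1 = 0 := by rw [d_eq]
@[simp] theorem d_neg (a : J) (a' : J') : (C.d a a').2.1 = C.dAct a a' := by rw [d_eq]
@[simp] theorem d_pos (a : J) (a' : J') : (C.d a a').2.2.1 = C.dAct a a' := by rw [d_eq]
@[simp] theorem d_two (a : J) (a' : J') : (C.d a a').2.2.2 = 0 := by rw [d_eq]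

/-! ### The brackets between `L₋₁` and `L₁` -/

theorem form_eq (p q : Quad k J J') :
    C.form p q = C.T p.2.1 q.2.2.1 - C.T q.2.1 p.2.2.1 + p.2.2.2 * q.1 - p.1 * q.2.2.2 := rfl

theorem middle_eq (p q : Quad k J J') : C.middle p q =
    C.ad' (-(p.1 • q.2.2.1) + C.cross p.2.1 q.2.1 - q.1 • p.2.2.1) +
      ((p.1 * q.2.2.2 - C.T p.2.1 q.2.2.1) • zeta k J J' +
        (C.T q.2.1 p.2.2.1 - p.2.2.2 * q.1) • (xi k J J' - zeta k J J') +
        C.d p.2.1 q.2.2.1 + C.d q.2.1 p.2.2.1) +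
      C.ad (-(q.2.2.2 • p.2.1) + C.cross' p.2.2.1 q.2.2.1 - p.2.2.2 • q.2.1) := rfl

theorem form_add_left (p₁ p₂ q : Quad k J J') :
    C.form (p₁ + p₂) q = C.form p₁ q + C.form p₂ q := by
  simp [form_eq]; ring

theorem form_smul_left (t : k) (p q : Quad k J J') : C.form (t • p) q = t * C.form p q := by
  simp [form_eq]; ring

theorem form_self (p : Quad k J J') : C.form p p = 0 := by
  simp [form_eq]; ring

theorem form_swap (p q : Quad k J J') : C.form q p = -C.form p q := by
  simp [form_eq]; ring

theorem form_add_right (p q₁ q₂ : Quad k J J') :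
    C.form p (q₁ + q₂) = C.form p q₁ + C.form p q₂ := by
  simp [form_eq]; ring

theorem form_smul_right (t : k) (p q : Quad k J J') : C.form p (t • q) = t * C.form p q := by
  simp [form_eq]; ring

/-- The Jacobi identity for `x`, `p₊`, `q₊`: the difference of the two sides of `L₋₁ × L₁` is `[x,
⟨p, q⟩ y]`. -/
theorem middle_swap (p q : Quad k J J') :
    C.middle q p = C.middle p q + C.form p q • xi k J J' := by
  rw [middle_eq, middle_eq, form_eq, C.cross_symm q.2.1, C.cross'_symm q.2.2.1]
  simp only [map_add, map_sub, map_neg, map_smul]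
  module

theorem middle_add_left (p₁ p₂ q : Quad k J J') :
    C.middle (p₁ + p₂) q = C.middle p₁ q + C.middle p₂ q := by
  simp only [middle_eq, Prod.fst_add, Prod.snd_add, d_add_left, d_add_right, map_add, map_sub,
    map_neg, map_smul, LinearMap.add_apply]
  module

theorem middle_smul_left (t : k) (p q : Quad k J J') :
    C.middle (t • p) q = t • C.middle p q := by
  simp only [middle_eq, Prod.smul_fst, Prod.smul_snd, d_smul_left, d_smul_right, map_add, map_sub,
    map_neg, map_smul, LinearMap.smul_apply, smul_eq_mul]
  module

theorem middle_add_right (p q₁ q₂ : Quad k J J') :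
    C.middle p (q₁ + q₂) = C.middle p q₁ + C.middle p q₂ := by
  simp only [middle_eq, Prod.fst_add, Prod.snd_add, d_add_left, d_add_right, map_add, map_sub,
    map_neg, map_smul, LinearMap.add_apply]
  module

theorem middle_smul_right (t : k) (p q : Quad k J J') :
    C.middle p (t • q) = t • C.middle p q := by
  simp only [middle_eq, Prod.smul_fst, Prod.smul_snd, d_smul_left, d_smul_right, map_add, map_sub,
    map_neg, map_smul, LinearMap.smul_apply, smul_eq_mul]
  module

/-- The Jacobi identity for `p₋`, `q₊`, `x`; the terms `𝐝`, `J` and `J'` vanish on `x`, so only `ζ`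
and `ξ` contribute. -/
theorem middle_negTwo (p q : Quad k J J') : (C.middle p q).1 1 = C.form p q := by
  simp [middle_eq, form_eq]; ring

theorem middle_two (p q : Quad k J J') : (C.middle p q).2.2.2 1 = -C.form p q := by
  simp [middle_eq, form_eq]; ring

end CubicNormPair

/-! ### Jacobi identities outside `L₀`, and `L₀` as derivations -/

namespace CubicNormPair

variable {k : Type u} {J : Type v} {J' : Type w} [CommRing k] [AddCommGroup J] [Module k J]
  [AddCommGroup J'] [Module k J'] (C : CubicNormPair k J J')

/-- The Jacobi identity for `p₋`, `q₋`, `r₊`, where `[[p₋, q₋], r₊] = ⟨p, q⟩ [x, r₊]`. The terms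
with nested products cancel by the symmetry of `×` alone. -/
theorem middle_neg_apply (p q r : Quad k J J') : (C.middle p r).2.1 q - (C.middle q r).2.1 p
    = -C.form p q • r := by
  refine quad_ext ?_ ?_ ?_ ?_
  · simp [middle_eq, form_eq]
    simp only [C.T_cross_left_comm]
    ring1
  · simp [middle_eq, form_eq]
    simp only [C.cross_symm, C.cross'_symm]
    module
  · simp [middle_eq, form_eq]
    simp only [C.cross_symm, C.cross'_symm]
    module
  · simp [middle_eq, form_eq]
    simp only [C.T_cross'_left_comm]
    ring1

/-- This reduces the Jacobi identity for one element of `L₋₁` and two of `L₁` to `middle_neg_apply`.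
-/
theorem middle_pos_apply (p q r : Quad k J J') : (C.middle p q).2.2.1 r = (C.middle q p).2.1 r := by
  refine quad_ext ?_ ?_ ?_ ?_
  · simp [middle_eq]
    simp only [C.cross_symm, C.T_cross_left_comm]
    ring1
  · simp [middle_eq]
    simp only [C.cross_symm, C.cross'_symm]
    module
  · simp [middle_eq]
    simp only [C.cross_symm, C.cross'_symm]
    module
  · simp [middle_eq]
    simp only [C.cross'_symm]
    ring1


theorem T_cross'_right_comm (a b c : J') : C.T (C.cross' a b) c = C.T (C.cross' a c) b := by
  rw [C.T_cross', C.T_cross', C.cross'_symm]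

theorem d_zero_left (c : J') : C.d 0 c = 0 := by
  simp [d]

theorem d_zero_right (a : J) : C.d a 0 = 0 := by
  simp [d]

theorem d_neg_left (a : J) (c : J') : C.d (-a) c = -C.d a c :=
  eq_neg_of_add_eq_zero_left (by rw [← d_add_left, neg_add_cancel, d_zero_left])

theorem d_neg_right (a : J) (c : J') : C.d a (-c) = -C.d a c :=
  eq_neg_of_add_eq_zero_left (by rw [← d_add_right, neg_add_cancel, d_zero_right])

theorem d_sub_left (a b : J) (c : J') : C.d (a - b) c = C.d a c - C.d b c := by
  rw [sub_eq_add_neg, d_add_left, d_neg_left, ← sub_eq_add_neg]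

theorem d_sub_right (a : J) (b c : J') : C.d a (b - c) = C.d a b - C.d a c := by
  rw [sub_eq_add_neg, d_add_right, d_neg_right, ← sub_eq_add_neg]

/-- The elements of `M` which act as derivations with respect to all brackets between the
nonzero components. -/
structure IsDer (φ : GlSum k J J') : Prop where
  -- Let `s` be the scalar by which `φ` acts on `x`. The first condition comes from `[x, y] = ξ`,
  -- which commutes with `φ`, and the second from `[x, p₊] = -p₋`. They imply the derivation rules
  -- for `[y, p₋]` and, together with `form`, for the bracket on `L₁`.
  two : φ.2.2.2 1 = -φ.1 1
  pos : ∀ p, φ.2.2.1 p = φ.2.1 p - φ.1 1 • p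
  form : ∀ p q, C.form (φ.2.1 p) q + C.form p (φ.2.1 q) = φ.1 1 * C.form p q
  middle : ∀ p q, φ * C.middle p q - C.middle p q * φ
    = C.middle (φ.2.1 p) q + C.middle p (φ.2.2.1 q)

theorem isDer_ad (a : J) : C.IsDer (C.ad a) where
  two := by simp
  pos p := by simp
  form p q := by
    simp only [ad_neg, ad_negTwo, form_eq, act_apply]
    simp
    simp only [C.cross_symm, C.T_cross_left_comm]
    ring1
  middle p q := by
    have e : C.ad a * C.middle p q - C.middle p q * C.ad a =
      -C.d a (-(p.1 • q.2.2.1) + C.cross p.2.1 q.2.1 - q.1 • p.2.2.1)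
       - ((p.1 * q.2.2.2 - C.T p.2.1 q.2.2.1) - (C.T q.2.1 p.2.2.1 - p.2.2.2 * q.1)) • C.ad a
       - C.ad (C.T p.2.1 q.2.2.1 • a + C.T a q.2.2.1 • p.2.1
          - C.cross' q.2.2.1 (C.cross p.2.1 a))
       - C.ad (C.T q.2.1 p.2.2.1 • a + C.T a p.2.2.1 • q.2.1
          - C.cross' p.2.2.1 (C.cross q.2.1 a)) := by
      have h₁ := C.ad_mul_ad a (-(q.2.2.2 • p.2.1) + C.cross' p.2.2.1 q.2.2.1 - p.2.2.2 • q.2.1)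
      have h₂ := C.ad'_mul_ad a (-(p.1 • q.2.2.1) + C.cross p.2.1 q.2.1 - q.1 • p.2.2.1)
      have h₃ := C.d_mul_ad p.2.1 a q.2.2.1
      have h₄ := C.d_mul_ad q.2.1 a p.2.2.1
      have h₅ := C.zeta_mul_ad a
      have h₆ := xi_mul (C.ad a)
      -- Turning the closed forms back into commutators leaves an identity that is linear in the
      -- products occurring in it.
      rw [middle_eq, ← h₂, ← h₃, ← h₄]
      simp only [mul_add, add_mul, mul_smul_comm, smul_mul_assoc, mul_sub, sub_mul, h₆]
      linear_combination (norm := module) h₁ -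
        ((p.1 * q.2.2.2 - C.T p.2.1 q.2.2.1) - (C.T q.2.1 p.2.2.1 - p.2.2.2 * q.1)) • h₅
    -- The term `𝐝_{a, b×c}` from the commutator and the terms `𝐝_{b, a×c}`, `𝐝_{c, a×b}` from the
    -- right-hand side form a cyclic sum. All other terms match formally.
    have h := C.d_cross_cyclic a p.2.1 q.2.1
    rw [e, middle_eq, middle_eq]
    simp only [ad_neg, ad_pos, act_apply, d_add_right, d_smul_left, d_smul_right, d_neg_right,
      d_sub_right, map_add, map_sub, map_smul, map_neg, map_zero, mul_zero, zero_mul,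
      zero_smul, LinearMap.smul_apply]
    simp only [C.cross_symm, C.cross'_symm, C.T_cross_left_comm] at h ⊢
    linear_combination (norm := module) -h

theorem isDer_ad' (a : J') : C.IsDer (C.ad' a) where
  two := by simp
  pos p := by simp
  form p q := by
    simp only [ad'_neg, ad'_negTwo, form_eq, act'_apply]
    simp
    simp only [C.T_cross'_right_comm]
    ring1
  middle p q := by
    have e : C.ad' a * C.middle p q - C.middle p q * C.ad' a =
      C.d (-(q.2.2.2 • p.2.1) + C.cross' p.2.2.1 q.2.2.1 - p.2.2.2 • q.2.1) a
       + ((p.1 * q.2.2.2 - C.T p.2.1 q.2.2.1) - (C.T q.2.1 p.2.2.1 - p.2.2.2 * q.1)) • C.ad' a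
       - C.ad' (C.cross p.2.1 (C.cross' q.2.2.1 a) - C.T p.2.1 q.2.2.1 • a
          - C.T p.2.1 a • q.2.2.1)
       - C.ad' (C.cross q.2.1 (C.cross' p.2.2.1 a) - C.T q.2.1 p.2.2.1 • a
          - C.T q.2.1 a • p.2.2.1) := by
      have h₁ := C.ad'_mul_ad' a (-(p.1 • q.2.2.1) + C.cross p.2.1 q.2.1 - q.1 • p.2.2.1)
      have h₂ := C.ad'_mul_ad (-(q.2.2.2 • p.2.1) + C.cross' p.2.2.1 q.2.2.1 - p.2.2.2 • q.2.1) a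
      have h₃ := C.d_mul_ad' p.2.1 q.2.2.1 a
      have h₄ := C.d_mul_ad' q.2.1 p.2.2.1 a
      have h₅ := C.zeta_mul_ad' a
      have h₆ := xi_mul (C.ad' a)
      rw [middle_eq, ← h₂, ← h₃, ← h₄]
      simp only [mul_add, add_mul, mul_smul_comm, smul_mul_assoc, mul_sub, sub_mul, h₆]
      linear_combination (norm := module) h₁ -
        ((p.1 * q.2.2.2 - C.T p.2.1 q.2.2.1) - (C.T q.2.1 p.2.2.1 - p.2.2.2 * q.1)) • h₅
    have h := C.d_cross'_cyclic a p.2.2.1 q.2.2.1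
    rw [e, middle_eq, middle_eq]
    simp only [ad'_neg, ad'_pos, act'_apply, d_add_left, d_smul_left, d_smul_right, d_neg_left,
      d_neg_right, d_sub_left, map_add, map_sub, map_smul, map_neg, map_zero, mul_zero,
      zero_mul, zero_smul, LinearMap.smul_apply, LinearMap.neg_apply]
    simp only [C.cross_symm, C.cross'_symm, C.T_cross'_right_comm] at h ⊢
    linear_combination (norm := module) h

theorem isDer_xi : C.IsDer (xi k J J') where
  two := by simp
  pos p := by simp; module
  form p q := by simp [form_eq]; ring
  middle p q := by
    rw [xi_mul, sub_self]
    have e : -p = (-1 : k) • p := by module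
    simp only [xi_neg, xi_pos, LinearMap.neg_apply, Module.End.one_apply, e, middle_smul_left]
    module

theorem isDer_zeta : C.IsDer (zeta k J J') where
  two := by simp
  pos p := by refine quad_ext ?_ ?_ ?_ ?_ <;> simp <;> ring
  form p q := by simp [form_eq]; ring
  middle p q := by
    have h₁ := C.zeta_mul_ad (-(q.2.2.2 • p.2.1) + C.cross' p.2.2.1 q.2.2.1 - p.2.2.2 • q.2.1)
    have h₂ := C.zeta_mul_ad' (-(p.1 • q.2.2.1) + C.cross p.2.1 q.2.1 - q.1 • p.2.2.1)
    have h₃ := C.zeta_mul_d p.2.1 q.2.2.1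
    have h₄ := C.zeta_mul_d q.2.1 p.2.2.1
    have h₅ := xi_mul (zeta k J J')
    have e : zeta k J J' * C.middle p q - C.middle p q * zeta k J J'
        = C.ad (-(q.2.2.2 • p.2.1) + C.cross' p.2.2.1 q.2.2.1 - p.2.2.2 • q.2.1)
          - C.ad' (-(p.1 • q.2.2.1) + C.cross p.2.1 q.2.1 - q.1 • p.2.2.1) := by
      rw [middle_eq]
      simp only [mul_add, add_mul, mul_smul_comm, smul_mul_assoc, mul_sub, sub_mul, h₅]
      linear_combination (norm := module) h₁ + h₂ + h₃ + h₄
    rw [e, middle_eq, middle_eq]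
    simp only [zeta_neg_apply, zeta_pos_apply, d_neg_left, d_zero_left, d_zero_right, map_add, map_sub, map_smul,
      map_neg, map_zero, LinearMap.neg_apply, LinearMap.zero_apply, smul_zero]
    module

variable {C}

theorem IsDer.add {φ ψ : GlSum k J J'} (hφ : C.IsDer φ) (hψ : C.IsDer ψ) : C.IsDer (φ + ψ) where
  two := by simp [hφ.two, hψ.two]; ring
  pos p := by simp [hφ.pos, hψ.pos]; module
  form p q := by
    have h₁ := hφ.form p q
    have h₂ := hψ.form p q
    simp only [Prod.fst_add, Prod.snd_add, LinearMap.add_apply, form_add_left, form_add_right]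
    linear_combination h₁ + h₂
  middle p q := by
    have h₁ := hφ.middle p q
    have h₂ := hψ.middle p q
    simp only [Prod.fst_add, Prod.snd_add, LinearMap.add_apply, middle_add_left,
      middle_add_right, add_mul, mul_add]
    linear_combination (norm := module) h₁ + h₂

theorem IsDer.smul (t : k) {φ : GlSum k J J'} (hφ : C.IsDer φ) : C.IsDer (t • φ) where
  two := by simp [hφ.two]
  pos p := by simp [hφ.pos]; module
  form p q := by
    have h₁ := hφ.form p q
    simp only [Prod.smul_fst, Prod.smul_snd, LinearMap.smul_apply, form_smul_left,
      form_smul_right, smul_eq_mul]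
    linear_combination t * h₁
  middle p q := by
    have h₁ := hφ.middle p q
    simp only [Prod.smul_fst, Prod.smul_snd, LinearMap.smul_apply, middle_smul_left,
      middle_smul_right, smul_mul_assoc, mul_smul_comm]
    linear_combination (norm := module) t • h₁

variable (C) in
theorem form_sub_left (p₁ p₂ q : Quad k J J') :
    C.form (p₁ - p₂) q = C.form p₁ q - C.form p₂ q := by
  simp [form_eq]; ring

variable (C) in
theorem form_sub_right (p q₁ q₂ : Quad k J J') :
    C.form p (q₁ - q₂) = C.form p q₁ - C.form p q₂ := by
  simp [form_eq]; ring

variable (C) in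
theorem middle_sub_left (p₁ p₂ q : Quad k J J') :
    C.middle (p₁ - p₂) q = C.middle p₁ q - C.middle p₂ q := by
  rw [sub_eq_add_neg, ← neg_one_smul k p₂, middle_add_left, middle_smul_left]
  module

variable (C) in
theorem middle_sub_right (p q₁ q₂ : Quad k J J') :
    C.middle p (q₁ - q₂) = C.middle p q₁ - C.middle p q₂ := by
  rw [sub_eq_add_neg, ← neg_one_smul k q₂, middle_add_right, middle_smul_right]
  module

/-- This covers the generators `𝐝_{a,a'}` of `Z` without a separate calculation. -/
theorem IsDer.commutator {φ ψ : GlSum k J J'} (hφ : C.IsDer φ) (hψ : C.IsDer ψ) :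
    C.IsDer (φ * ψ - ψ * φ) where
  two := by
    have h₁ := End_apply_ring φ.1 (ψ.1 1)
    have h₂ := End_apply_ring ψ.1 (φ.1 1)
    have h₃ := End_apply_ring φ.2.2.2 (ψ.2.2.2 1)
    have h₄ := End_apply_ring ψ.2.2.2 (φ.2.2.2 1)
    simp only [Prod.fst_sub, Prod.snd_sub, Prod.fst_mul, Prod.snd_mul, LinearMap.sub_apply,
      Module.End.mul_apply, h₁, h₂, h₃, h₄]
    ring
  pos p := by
    have h₁ := End_apply_ring φ.1 (ψ.1 1)
    have h₂ := End_apply_ring ψ.1 (φ.1 1)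
    simp only [Prod.fst_sub, Prod.snd_sub, Prod.fst_mul, Prod.snd_mul, LinearMap.sub_apply,
      Module.End.mul_apply, h₁, h₂, hφ.pos, hψ.pos, map_sub,
      map_smul]
    module
  form p q := by
    have h₁ := hφ.form (ψ.2.1 p) q
    have h₂ := hφ.form p (ψ.2.1 q)
    have h₃ := hψ.form (φ.2.1 p) q
    have h₄ := hψ.form p (φ.2.1 q)
    have h₅ := hψ.form p q
    have h₆ := hφ.form p q
    have e₁ := End_apply_ring φ.1 (ψ.1 1)
    have e₂ := End_apply_ring ψ.1 (φ.1 1)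
    simp only [Prod.fst_sub, Prod.snd_sub, Prod.fst_mul, Prod.snd_mul, LinearMap.sub_apply,
      Module.End.mul_apply, e₁, e₂, form_sub_left, form_sub_right]
    linear_combination h₁ + h₂ - h₃ - h₄ + φ.1 1 * h₅ - ψ.1 1 * h₆
  middle p q := by
    have h₁ := hφ.middle (ψ.2.1 p) q
    have h₂ := hφ.middle p (ψ.2.2.1 q)
    have h₃ := hψ.middle (φ.2.1 p) q
    have h₄ := hψ.middle p (φ.2.2.1 q)
    -- Bracketing the rule for `ψ` with `φ`, and conversely, produces the double commutators with
    -- `middle p q`.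
    have h₅ := congrArg (fun m => φ * m - m * φ) (hψ.middle p q)
    have h₆ := congrArg (fun m => ψ * m - m * ψ) (hφ.middle p q)
    simp only [mul_sub, sub_mul, mul_add, add_mul, ← mul_assoc] at h₅ h₆
    simp only [Prod.fst_sub, Prod.snd_sub, Prod.fst_mul, Prod.snd_mul, LinearMap.sub_apply,
      Module.End.mul_apply, middle_sub_left, middle_sub_right, sub_mul, mul_sub, ← mul_assoc]
    linear_combination (norm := module) h₁ + h₂ - h₃ - h₄ + h₅ - h₆

theorem isDer_of_mem_L₀ {φ : GlSum k J J'} (h : φ ∈ C.L₀) : C.IsDer φ := by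
  let D : Submodule k (GlSum k J J') :=
    { carrier := {φ | C.IsDer φ}
      add_mem' := IsDer.add
      zero_mem' := by simpa using C.isDer_xi.smul 0
      smul_mem' := fun t φ hφ => IsDer.smul t hφ }
  suffices C.L₀ ≤ D from this h
  refine sup_le (sup_le ?_ (sup_le (sup_le ?_ ?_) ?_)) ?_
  · rintro _ ⟨a, rfl⟩
    exact C.isDer_ad' a
  · rw [Submodule.span_le]
    rintro _ ⟨a, rfl⟩
    exact (C.isDer_ad' a.2).commutator (C.isDer_ad a.1)
  · rw [Submodule.span_le, Set.singleton_subset_iff]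
    exact C.isDer_zeta
  · rw [Submodule.span_le, Set.singleton_subset_iff]
    exact C.isDer_xi
  · rintro _ ⟨a, rfl⟩
    exact C.isDer_ad a

end CubicNormPair

/-! ### Closure of `L₀` under commutators, and bilinearity of the bracket -/

namespace CubicNormPair

variable {k : Type u} {J : Type v} {J' : Type w} [CommRing k] [AddCommGroup J] [Module k J]
  [AddCommGroup J'] [Module k J'] (C : CubicNormPair k J J')

/-- The map `φ ↦ [φ, ψ]` on `M`. -/
def commRight (ψ : GlSum k J J') : GlSum k J J' →ₗ[k] GlSum k J J' :=
  LinearMap.mulRight k ψ - LinearMap.mulLeft k ψ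

theorem commRight_apply (φ ψ : GlSum k J J') : commRight ψ φ = φ * ψ - ψ * φ := rfl

theorem d_mem_Z (a : J) (a' : J') : C.d a a' ∈ C.Z :=
  Submodule.mem_sup_left (Submodule.mem_sup_left (Submodule.subset_span ⟨(a, a'), rfl⟩))

theorem zeta_mem_Z : zeta k J J' ∈ C.Z :=
  Submodule.mem_sup_left (Submodule.mem_sup_right (Submodule.mem_span_singleton_self _))

theorem xi_mem_Z : xi k J J' ∈ C.Z :=
  Submodule.mem_sup_right (Submodule.mem_span_singleton_self _)

theorem Z_le {S : Submodule k (GlSum k J J')} (hd : ∀ a a', C.d a a' ∈ S)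
    (hζ : zeta k J J' ∈ S) (hξ : xi k J J' ∈ S) : C.Z ≤ S := by
  refine sup_le (sup_le ?_ ?_) ?_ <;> rw [Submodule.span_le]
  · rintro _ ⟨a, rfl⟩
    exact hd _ _
  · exact Set.singleton_subset_iff.2 hζ
  · exact Set.singleton_subset_iff.2 hξ

theorem xi_comm (φ : GlSum k J J') : xi k J J' * φ - φ * xi k J J' = 0 := by
  rw [xi_mul, sub_self]

variable {C}

theorem comm_ad_mem_of_mem_Z {φ : GlSum k J J'} (h : φ ∈ C.Z) (c : J) :
    φ * C.ad c - C.ad c * φ ∈ LinearMap.range C.ad := by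
  suffices C.Z ≤ (LinearMap.range C.ad).comap (commRight (C.ad c)) from this h
  refine C.Z_le (fun a a' => ?_) ?_ ?_ <;> rw [Submodule.mem_comap, commRight_apply]
  · exact ⟨_, (C.d_mul_ad a c a').symm⟩
  · exact ⟨c, (C.zeta_mul_ad c).symm⟩
  · rw [xi_comm]
    exact zero_mem _

theorem comm_ad'_mem_of_mem_Z {φ : GlSum k J J'} (h : φ ∈ C.Z) (c : J') :
    φ * C.ad' c - C.ad' c * φ ∈ LinearMap.range C.ad' := by
  suffices C.Z ≤ (LinearMap.range C.ad').comap (commRight (C.ad' c)) from this h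
  refine C.Z_le (fun a a' => ?_) ?_ ?_ <;> rw [Submodule.mem_comap, commRight_apply]
  · exact ⟨_, (C.d_mul_ad' a a' c).symm⟩
  · rw [C.zeta_mul_ad' c]
    exact neg_mem ⟨c, rfl⟩
  · rw [xi_comm]
    exact zero_mem _

theorem zeta_comm_of_mem_Z {φ : GlSum k J J'} (h : φ ∈ C.Z) :
    φ * zeta k J J' - zeta k J J' * φ = 0 := by
  suffices C.Z ≤ LinearMap.ker (commRight (zeta k J J')) from this h
  refine C.Z_le (fun a a' => ?_) ?_ ?_ <;> rw [LinearMap.mem_ker, commRight_apply]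
  · rw [← neg_sub, C.zeta_mul_d, neg_zero]
  · exact sub_self _
  · exact xi_comm _

/-- Since `ψ` normalizes the images of `J` and `J'`, the Jacobi identity in `M` turns `[ψ,
𝐝_{a,a'}]` into a sum of two elements of the form `𝐝`. -/
theorem comm_mem_Z {φ ψ : GlSum k J J'} (hφ : φ ∈ C.Z) (hψ : ψ ∈ C.Z) :
    φ * ψ - ψ * φ ∈ C.Z := by
  suffices C.Z ≤ C.Z.comap (commRight ψ) from this hφ
  refine C.Z_le (fun a a' => ?_) ?_ ?_ <;> rw [Submodule.mem_comap, commRight_apply]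
  · obtain ⟨e, he⟩ := comm_ad_mem_of_mem_Z hψ a
    obtain ⟨e', he'⟩ := comm_ad'_mem_of_mem_Z hψ a'
    have : C.d a a' * ψ - ψ * C.d a a' = -C.d a e' - C.d e a' := by
      rw [d, d, d, he, he']
      simp only [mul_sub, sub_mul, mul_assoc]
      abel
    rw [this]
    exact sub_mem (neg_mem (C.d_mem_Z _ _)) (C.d_mem_Z _ _)
  · rw [← neg_sub, zeta_comm_of_mem_Z hψ, neg_zero]
    exact zero_mem _
  · rw [xi_comm]
    exact zero_mem _

variable (C) in
/-- The homogeneous components of `L₀`. -/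
def zeroPiece : ℤ → Submodule k (GlSum k J J')
  | -1 => LinearMap.range C.ad'
  | 0 => C.Z
  | 1 => LinearMap.range C.ad
  | _ => ⊥

theorem zeroPiece_le_L₀ (i : ℤ) : C.zeroPiece i ≤ C.L₀ := by
  unfold zeroPiece
  split
  · exact le_sup_left.trans le_sup_left
  · exact le_sup_right.trans le_sup_left
  · exact le_sup_right
  · exact bot_le

theorem comm_swap_mem {S : Submodule k (GlSum k J J')} {φ ψ : GlSum k J J'}
    (h : φ * ψ - ψ * φ ∈ S) : ψ * φ - φ * ψ ∈ S := by
  rw [← neg_sub]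
  exact neg_mem h

theorem comm_mem_zeroPiece {i j : ℤ} {φ ψ : GlSum k J J'} (hφ : φ ∈ C.zeroPiece i)
    (hψ : ψ ∈ C.zeroPiece j) : φ * ψ - ψ * φ ∈ C.zeroPiece (i + j) := by
  unfold zeroPiece at hφ hψ
  split at hφ <;> split at hψ
  · obtain ⟨a, rfl⟩ := hφ
    obtain ⟨b, rfl⟩ := hψ
    rw [C.ad'_mul_ad']
    exact zero_mem _
  · obtain ⟨a, rfl⟩ := hφ
    exact comm_swap_mem (comm_ad'_mem_of_mem_Z hψ a)
  · obtain ⟨a, rfl⟩ := hφ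
    obtain ⟨b, rfl⟩ := hψ
    exact C.d_mem_Z b a
  · obtain rfl := (Submodule.mem_bot k).1 hψ
    simp
  · obtain ⟨b, rfl⟩ := hψ
    exact comm_ad'_mem_of_mem_Z hφ b
  · exact comm_mem_Z hφ hψ
  · obtain ⟨b, rfl⟩ := hψ
    exact comm_ad_mem_of_mem_Z hφ b
  · obtain rfl := (Submodule.mem_bot k).1 hψ
    simp
  · obtain ⟨a, rfl⟩ := hφ
    obtain ⟨b, rfl⟩ := hψ
    exact comm_swap_mem (C.d_mem_Z a b)
  · obtain ⟨a, rfl⟩ := hφ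
    exact comm_swap_mem (comm_ad_mem_of_mem_Z hψ a)
  · obtain ⟨a, rfl⟩ := hφ
    obtain ⟨b, rfl⟩ := hψ
    rw [C.ad_mul_ad]
    exact zero_mem _
  · obtain rfl := (Submodule.mem_bot k).1 hψ
    simp
  all_goals
    obtain rfl := (Submodule.mem_bot k).1 hφ
    simp

theorem exists_of_mem_L₀ {φ : GlSum k J J'} (h : φ ∈ C.L₀) :
    ∃ φ₁ ∈ C.zeroPiece (-1), ∃ φ₂ ∈ C.zeroPiece 0, ∃ φ₃ ∈ C.zeroPiece 1, φ = φ₁ + φ₂ + φ₃ := by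
  obtain ⟨_, h₀, φ₃, h₃, rfl⟩ := Submodule.mem_sup.1 h
  obtain ⟨φ₁, h₁, φ₂, h₂, rfl⟩ := Submodule.mem_sup.1 h₀
  exact ⟨φ₁, h₁, φ₂, h₂, φ₃, h₃, rfl⟩

theorem comm_mem_L₀ {φ ψ : GlSum k J J'} (hφ : φ ∈ C.L₀) (hψ : ψ ∈ C.L₀) :
    φ * ψ - ψ * φ ∈ C.L₀ := by
  obtain ⟨φ₁, h₁, φ₂, h₂, φ₃, h₃, rfl⟩ := exists_of_mem_L₀ hφ
  have key : ∀ {i : ℤ} {χ : GlSum k J J'}, χ ∈ C.zeroPiece i → χ * ψ - ψ * χ ∈ C.L₀ := by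
    intro i χ hχ
    obtain ⟨ψ₁, h₁, ψ₂, h₂, ψ₃, h₃, rfl⟩ := exists_of_mem_L₀ hψ
    have e : χ * (ψ₁ + ψ₂ + ψ₃) - (ψ₁ + ψ₂ + ψ₃) * χ
        = (χ * ψ₁ - ψ₁ * χ) + (χ * ψ₂ - ψ₂ * χ) + (χ * ψ₃ - ψ₃ * χ) := by
      noncomm_ring
    rw [e]
    exact add_mem (add_mem (zeroPiece_le_L₀ _ (comm_mem_zeroPiece hχ h₁))
      (zeroPiece_le_L₀ _ (comm_mem_zeroPiece hχ h₂)))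
      (zeroPiece_le_L₀ _ (comm_mem_zeroPiece hχ h₃))
  have e : (φ₁ + φ₂ + φ₃) * ψ - ψ * (φ₁ + φ₂ + φ₃)
      = (φ₁ * ψ - ψ * φ₁) + (φ₂ * ψ - ψ * φ₂) + (φ₃ * ψ - ψ * φ₃) := by
    noncomm_ring
  rw [e]
  exact add_mem (add_mem (key h₁) (key h₂)) (key h₃)

variable (C)

theorem middle_mem_L₀ (p q : Quad k J J') : C.middle p q ∈ C.L₀ := by
  rw [middle_eq]
  refine add_mem (add_mem (zeroPiece_le_L₀ (-1) (LinearMap.mem_range_self C.ad' _))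
    (zeroPiece_le_L₀ 0 ?_)) (zeroPiece_le_L₀ 1 (LinearMap.mem_range_self C.ad _))
  exact add_mem (add_mem (add_mem (C.Z.smul_mem _ C.zeta_mem_Z)
    (C.Z.smul_mem _ (sub_mem C.xi_mem_Z C.zeta_mem_Z))) (C.d_mem_Z _ _)) (C.d_mem_Z _ _)

theorem bracket_eq (x y : Ambient k J J') : C.bracket x y =
    ( x.2.2.1.1 y.1 - y.2.2.1.1 x.1 + C.form x.2.1 y.2.1,
      x.2.2.1.2.1 y.2.1 - y.2.2.1.2.1 x.2.1 - x.1 • y.2.2.2.1 + y.1 • x.2.2.2.1,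
      x.2.2.1 * y.2.2.1 - y.2.2.1 * x.2.2.1 + C.middle x.2.1 y.2.2.2.1
        - C.middle y.2.1 x.2.2.2.1 + (x.1 * y.2.2.2.2 - y.1 * x.2.2.2.2) • xi k J J',
      x.2.2.1.2.2.1 y.2.2.2.1 - y.2.2.1.2.2.1 x.2.2.2.1 + x.2.2.2.2 • y.2.1 - y.2.2.2.2 • x.2.1,
      x.2.2.1.2.2.2 y.2.2.2.2 - y.2.2.1.2.2.2 x.2.2.2.2 + C.form x.2.2.2.1 y.2.2.2.1 ) := rfl

theorem bracket_self (x : Ambient k J J') : C.bracket x x = 0 := by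
  simp [bracket_eq, form_self]

theorem ambient_ext {x y : Ambient k J J'} (h₁ : x.1 = y.1) (h₂ : x.2.1 = y.2.1)
    (h₃ : x.2.2.1 = y.2.2.1) (h₄ : x.2.2.2.1 = y.2.2.2.1) (h₅ : x.2.2.2.2 = y.2.2.2.2) : x = y :=
  Prod.ext h₁ (Prod.ext h₂ (Prod.ext h₃ (Prod.ext h₄ h₅)))

theorem bracket_add_left (x y z : Ambient k J J') :
    C.bracket (x + y) z = C.bracket x z + C.bracket y z := by
  simp only [bracket_eq, Prod.fst_add, Prod.snd_add, LinearMap.add_apply, map_add, form_add_left,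
    middle_add_left, middle_add_right, add_mul, mul_add]
  refine ambient_ext ?_ ?_ ?_ ?_ ?_ <;> dsimp only [Prod.fst_add, Prod.snd_add] <;> module

theorem bracket_smul_left (t : k) (x y : Ambient k J J') :
    C.bracket (t • x) y = t • C.bracket x y := by
  simp only [bracket_eq, Prod.smul_fst, Prod.smul_snd, LinearMap.smul_apply, map_smul,
    form_smul_left, middle_smul_left, middle_smul_right, smul_mul_assoc, mul_smul_comm]
  refine ambient_ext ?_ ?_ ?_ ?_ ?_ <;> dsimp only [Prod.smul_fst, Prod.smul_snd, smul_eq_mul] <;>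
    first | ring1 | module

theorem bracket_swap (x y : Ambient k J J') : C.bracket y x = -C.bracket x y := by
  have h := C.form_swap
  refine ambient_ext ?_ ?_ ?_ ?_ ?_ <;> simp only [bracket_eq, Prod.fst_neg, Prod.snd_neg]
  · rw [h x.2.1]; ring
  · module
  · module
  · module
  · rw [h x.2.2.2.1]; ring

theorem bracket_add_right (x y z : Ambient k J J') :
    C.bracket x (y + z) = C.bracket x y + C.bracket x z := by
  rw [C.bracket_swap (y + z), bracket_add_left, C.bracket_swap y, C.bracket_swap z]
  abel

theorem bracket_smul_right (t : k) (x y : Ambient k J J') :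
    C.bracket x (t • y) = t • C.bracket x y := by
  rw [C.bracket_swap (t • y), bracket_smul_left, C.bracket_swap y, smul_neg]

theorem bracket_mem {x y : Ambient k J J'} (hx : x ∈ C.lieModule) (hy : y ∈ C.lieModule) :
    C.bracket x y ∈ C.lieModule := by
  refine ⟨trivial, trivial, ?_, trivial, trivial⟩
  exact add_mem (sub_mem (add_mem (comm_mem_L₀ hx.2.2.1 hy.2.2.1) (C.middle_mem_L₀ _ _))
    (C.middle_mem_L₀ _ _)) (C.L₀.smul_mem _ (zeroPiece_le_L₀ 0 C.xi_mem_Z))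

end CubicNormPair

/-! ### The Jacobi identity -/

namespace CubicNormPair

variable {k : Type u} {J : Type v} {J' : Type w} [CommRing k] [AddCommGroup J] [Module k J]
  [AddCommGroup J'] [Module k J'] (C : CubicNormPair k J J')

theorem middle_negTwo_apply (p q : Quad k J J') (t : k) :
    (C.middle p q).1 t = C.form p q * t := by
  rw [End_apply_ring, middle_negTwo, mul_comm]

theorem middle_two_apply (p q : Quad k J J') (t : k) :
    (C.middle p q).2.2.2 t = -C.form p q * t := by
  rw [End_apply_ring, middle_two, mul_comm]

variable {C} in
theorem IsDer.exists_scalar {φ : GlSum k J J'} (h : C.IsDer φ) :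
    ∃ s : k, (∀ t, φ.1 t = s * t) ∧ (∀ t, φ.2.2.2 t = -(s * t)) ∧
      (∀ p, φ.2.2.1 p = φ.2.1 p - s • p) ∧
      ∀ p q, C.form (φ.2.1 p) q + C.form p (φ.2.1 q) = s * C.form p q :=
  ⟨φ.1 1, fun t => by rw [End_apply_ring, mul_comm],
    fun t => by rw [End_apply_ring, h.two]; ring, h.pos, h.form⟩

-- On the whole ambient module the bracket need not satisfy the Jacobi identity; the components in
-- `M` have to act as derivations, as those in `L₀` do. The identity is compared in each of the five
-- degrees.
set_option linter.unusedSimpArgs false in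
theorem bracket_leibniz {x y z : Ambient k J J'} (hx : C.IsDer x.2.2.1) (hy : C.IsDer y.2.2.1)
    (hz : C.IsDer z.2.2.1) :
    C.bracket x (C.bracket y z) = C.bracket (C.bracket x y) z + C.bracket y (C.bracket x z) := by
  obtain ⟨α₁, p₁, φ₁, q₁, β₁⟩ := x
  obtain ⟨α₂, p₂, φ₂, q₂, β₂⟩ := y
  obtain ⟨α₃, p₃, φ₃, q₃, β₃⟩ := z
  dsimp only at hx hy hz
  obtain ⟨s₁, a₁, b₁, c₁, f₁⟩ := hx.exists_scalar
  obtain ⟨s₂, a₂, b₂, c₂, f₂⟩ := hy.exists_scalar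
  obtain ⟨s₃, a₃, b₃, c₃, f₃⟩ := hz.exists_scalar
  have hξ : ∀ t : k, (xi k J J').1 t = -(2 * t) := fun t => by simp
  have hξ' : ∀ t : k, (xi k J J').2.2.2 t = 2 * t := fun t => by simp
  refine ambient_ext ?_ ?_ ?_ ?_ ?_
  · simp only [bracket_eq, Prod.fst_add]
    simp only [Prod.fst_sub, Prod.fst_add, Prod.fst_mul, Prod.smul_fst, LinearMap.sub_apply,
      LinearMap.add_apply, LinearMap.smul_apply, Module.End.mul_apply, form_sub_left,
      form_sub_right, form_add_left, form_add_right, form_smul_left, form_smul_right,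
      middle_negTwo_apply, hξ, a₁, a₂, a₃, smul_eq_mul, C.form_swap _ q₁, C.form_swap _ q₂,
      C.form_swap p₃ q₁, C.form_swap p₃ q₂, C.form_swap (φ₃.2.1 p₁) p₂]
    linear_combination -f₁ p₂ p₃ + f₂ p₁ p₃ - f₃ p₁ p₂
  · simp only [bracket_eq, Prod.fst_add, Prod.snd_add]
    simp only [Prod.fst_sub, Prod.snd_sub, Prod.fst_add, Prod.snd_add, Prod.fst_mul, Prod.snd_mul,
      Prod.smul_fst, Prod.smul_snd, LinearMap.sub_apply, LinearMap.add_apply,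
      LinearMap.smul_apply, Module.End.mul_apply, map_add, map_sub, map_smul, c₁, c₂, c₃,
      a₁, a₂, a₃, xi_neg, LinearMap.neg_apply, Module.End.one_apply]
    -- Once `L₁`-actions are expressed through `L₋₁`-actions, three Jacobi identities of type `(L₋₁,
    -- L₋₁, L₁)` remain, one for each choice of the argument which supplies its `L₁`-component.
    linear_combination (norm := module) C.middle_neg_apply p₁ p₂ q₃
      - C.middle_neg_apply p₁ p₃ q₂ + C.middle_neg_apply p₂ p₃ q₁
  · simp only [bracket_eq, Prod.fst_add, Prod.snd_add]
    simp only [middle_sub_left, middle_sub_right, middle_add_left, middle_add_right,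
      middle_smul_left, middle_smul_right, mul_add, mul_sub, add_mul, sub_mul, mul_smul_comm,
      smul_mul_assoc, xi_mul, ← mul_assoc, a₁, a₂, a₃, b₁, b₂, b₃, C.middle_swap p₁ p₂,
      C.middle_swap p₁ p₃, C.middle_swap p₂ p₃, C.middle_swap q₁ q₂,
      C.middle_swap q₁ q₃, C.middle_swap q₂ q₃]
    -- Terms with a coefficient of `x` or `y` have already cancelled through `middle_swap`; the
    -- derivation rule for `middle` remains.
    linear_combination (norm := module) hx.middle p₂ q₃ - hx.middle p₃ q₂ + hz.middle p₁ q₂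
      - hz.middle p₂ q₁ - hy.middle p₁ q₃ + hy.middle p₃ q₁
  · simp only [bracket_eq, Prod.fst_add, Prod.snd_add]
    simp only [Prod.fst_sub, Prod.snd_sub, Prod.fst_add, Prod.snd_add, Prod.fst_mul, Prod.snd_mul,
      Prod.smul_fst, Prod.smul_snd, LinearMap.sub_apply, LinearMap.add_apply,
      LinearMap.smul_apply, Module.End.mul_apply, map_add, map_sub, map_smul, c₁, c₂, c₃,
      b₁, b₂, b₃, xi_pos, Module.End.one_apply, middle_pos_apply]
    linear_combination (norm := module) C.middle_neg_apply q₁ q₃ p₂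
      - C.middle_neg_apply q₁ q₂ p₃ - C.middle_neg_apply q₂ q₃ p₁
  · simp only [bracket_eq, Prod.fst_add, Prod.snd_add]
    simp only [Prod.fst_sub, Prod.snd_sub, Prod.fst_add, Prod.snd_add, Prod.fst_mul, Prod.snd_mul,
      Prod.smul_fst, Prod.smul_snd, LinearMap.sub_apply,
      LinearMap.add_apply, LinearMap.smul_apply, Module.End.mul_apply, form_sub_left,
      form_sub_right, form_add_left, form_add_right, form_smul_left, form_smul_right,
      middle_two_apply, hξ', b₁, b₂, b₃, c₁, c₂, c₃, smul_eq_mul, C.form_swap p₃ q₁,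
      C.form_swap p₃ q₂, C.form_swap (φ₃.2.1 q₁) q₂, C.form_swap p₁ q₂, C.form_swap p₁ q₃,
      C.form_swap p₂ q₁, C.form_swap p₂ q₃, C.form_swap q₁ q₂]
    linear_combination -f₁ q₂ q₃ + f₂ q₁ q₃ - f₃ q₁ q₂

/-- The Lie ring `L(J, J')`. -/
@[reducible]
def lieRing : LieRing C.lieModule where
  bracket x y := ⟨C.bracket x y, C.bracket_mem x.2 y.2⟩
  add_lie x y z := Subtype.ext (C.bracket_add_left x y z)
  lie_add x y z := Subtype.ext (C.bracket_add_right x y z)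
  lie_self x := Subtype.ext (C.bracket_self x)
  leibniz_lie x y z := Subtype.ext (C.bracket_leibniz (isDer_of_mem_L₀ x.2.2.2.1)
    (isDer_of_mem_L₀ y.2.2.2.1) (isDer_of_mem_L₀ z.2.2.2.1))

/-- The Lie algebra `L(J, J')`. -/
@[reducible]
def lieAlgebra : letI := C.lieRing; LieAlgebra k C.lieModule :=
  letI := C.lieRing
  { lie_smul := fun t x y => Subtype.ext (C.bracket_smul_right t x y) }

end CubicNormPair

/-! ### Degrees of the components in `ℤ²` -/

namespace CubicNormPair

variable {k : Type u} {J : Type v} {J' : Type w} [CommRing k] [AddCommGroup J] [Module k J]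
  [AddCommGroup J'] [Module k J'] (C : CubicNormPair k J J')

/-- The four coordinate submodules of the module of quadruples. -/
def quadPiece (k : Type u) (J : Type v) (J' : Type w) [CommRing k] [AddCommGroup J] [Module k J]
    [AddCommGroup J'] [Module k J'] : ℤ → Submodule k (Quad k J J')
  | 0 => LinearMap.range (quad₁ k J J')
  | 1 => LinearMap.range (quad₂ k J J')
  | 2 => LinearMap.range (quad₃ k J J')
  | 3 => LinearMap.range (quad₄ k J J')
  | _ => ⊥

/-- In this form degree arguments reduce to integer arithmetic. For `n` outside `0, …, 3` all four
coordinates must vanish, in accordance with the default value `⊥`. -/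
theorem mem_quadPiece {n : ℤ} {p : Quad k J J'} : p ∈ quadPiece k J J' n ↔
    (n ≠ 0 → p.1 = 0) ∧ (n ≠ 1 → p.2.1 = 0) ∧ (n ≠ 2 → p.2.2.1 = 0) ∧
      (n ≠ 3 → p.2.2.2 = 0) := by
  obtain ⟨l, b, b', m⟩ := p
  unfold quadPiece
  split
  · simp [quad₁, Prod.ext_iff, eq_comm]
  · simp [quad₂, Prod.ext_iff, eq_comm]
  · simp [quad₃, eq_comm]
  · simp [quad₄, eq_comm]
  · simp_all

theorem act_mem_quadPiece {n : ℤ} {p : Quad k J J'} (hp : p ∈ quadPiece k J J' n) (a : J) :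
    C.act a p ∈ quadPiece k J J' (n + 1) := by
  rw [mem_quadPiece] at hp ⊢
  refine ⟨fun _ => rfl, fun h => ?_, fun h => ?_, fun h => ?_⟩
  · simp [hp.1 (by omega)]
  · simp [hp.2.1 (by omega)]
  · simp [hp.2.2.1 (by omega)]

theorem act'_mem_quadPiece {n : ℤ} {p : Quad k J J'} (hp : p ∈ quadPiece k J J' n) (a : J') :
    C.act' a p ∈ quadPiece k J J' (n + -1) := by
  rw [mem_quadPiece] at hp ⊢
  refine ⟨fun h => ?_, fun h => ?_, fun h => ?_, fun _ => by simp⟩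
  · simp [hp.2.1 (by omega)]
  · simp [hp.2.2.1 (by omega)]
  · simp [hp.2.2.2 (by omega)]

/-- `J` shifts coordinates up, `J'` shifts them down, and the generators of `Z` act diagonally.
Shifts out of the range `0, …, 3` give zero. -/
theorem zeroPiece_neg_apply_mem {i n : ℤ} {φ : GlSum k J J'} {p : Quad k J J'}
    (hφ : φ ∈ C.zeroPiece i) (hp : p ∈ quadPiece k J J' n) :
    φ.2.1 p ∈ quadPiece k J J' (n + i) := by
  unfold zeroPiece at hφ
  split at hφ
  · obtain ⟨a, rfl⟩ := hφ
    exact C.act'_mem_quadPiece hp a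
  · rw [add_zero]
    suffices C.Z ≤ (quadPiece k J J' n).comap ((LinearMap.applyₗ p) ∘ₗ
      (LinearMap.fst k _ _ ∘ₗ LinearMap.snd k _ _)) from this hφ
    refine C.Z_le (fun a a' => ?_) ?_ ?_ <;> rw [Submodule.mem_comap, mem_quadPiece] <;>
      rw [mem_quadPiece] at hp <;>
      refine ⟨fun h => ?_, fun h => ?_, fun h => ?_, fun h => ?_⟩ <;>
      first | simp [hp.1 h] | simp [hp.2.1 h] | simp [hp.2.2.1 h] | simp [hp.2.2.2 h]
  · obtain ⟨a, rfl⟩ := hφ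
    exact C.act_mem_quadPiece hp a
  · obtain rfl := (Submodule.mem_bot k).1 hφ
    simp

theorem zeroPiece_pos_apply_mem {i n : ℤ} {φ : GlSum k J J'} {p : Quad k J J'}
    (hφ : φ ∈ C.zeroPiece i) (hp : p ∈ quadPiece k J J' n) :
    φ.2.2.1 p ∈ quadPiece k J J' (n + i) := by
  unfold zeroPiece at hφ
  split at hφ
  · obtain ⟨a, rfl⟩ := hφ
    exact C.act'_mem_quadPiece hp a
  · rw [add_zero]
    suffices C.Z ≤ (quadPiece k J J' n).comap ((LinearMap.applyₗ p) ∘ₗ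
      (LinearMap.fst k _ _ ∘ₗ LinearMap.snd k _ _ ∘ₗ LinearMap.snd k _ _)) from this hφ
    refine C.Z_le (fun a a' => ?_) ?_ ?_ <;> rw [Submodule.mem_comap, mem_quadPiece] <;>
      rw [mem_quadPiece] at hp <;>
      refine ⟨fun h => ?_, fun h => ?_, fun h => ?_, fun h => ?_⟩ <;>
      first | simp [hp.1 h] | simp [hp.2.1 h] | simp [hp.2.2.1 h] | simp [hp.2.2.2 h]
  · obtain ⟨a, rfl⟩ := hφ
    exact C.act_mem_quadPiece hp a
  · obtain rfl := (Submodule.mem_bot k).1 hφ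
    simp

theorem zeroPiece_scalar {i : ℤ} {φ : GlSum k J J'} (hφ : φ ∈ C.zeroPiece i) (hi : i ≠ 0) :
    φ.1 = 0 ∧ φ.2.2.2 = 0 := by
  unfold zeroPiece at hφ
  split at hφ
  · obtain ⟨a, rfl⟩ := hφ
    exact ⟨rfl, rfl⟩
  · exact absurd rfl hi
  · obtain ⟨a, rfl⟩ := hφ
    exact ⟨rfl, rfl⟩
  · obtain rfl := (Submodule.mem_bot k).1 hφ
    exact ⟨rfl, rfl⟩

theorem form_eq_zero_of_mem {n m : ℤ} {p q : Quad k J J'} (hp : p ∈ quadPiece k J J' n)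
    (hq : q ∈ quadPiece k J J' m) (h : n + m ≠ 3) : C.form p q = 0 := by
  rw [mem_quadPiece] at hp hq
  have h₁ : p.1 * q.2.2.2 = 0 := by
    by_cases hn : n = 0
    · rw [hq.2.2.2 (by omega), mul_zero]
    · rw [hp.1 hn, zero_mul]
  have h₂ : C.T p.2.1 q.2.2.1 = 0 := by
    by_cases hn : n = 1
    · rw [hq.2.2.1 (by omega), map_zero]
    · rw [hp.2.1 hn, map_zero, LinearMap.zero_apply]
  have h₃ : C.T q.2.1 p.2.2.1 = 0 := by
    by_cases hn : n = 2
    · rw [hq.2.1 (by omega), map_zero, LinearMap.zero_apply]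
    · rw [hp.2.2.1 hn, map_zero]
  have h₄ : p.2.2.2 * q.1 = 0 := by
    by_cases hn : n = 3
    · rw [hq.1 (by omega), mul_zero]
    · rw [hp.2.2.2 hn, zero_mul]
  rw [form_eq, h₁, h₂, h₃, h₄]
  ring

/-- The coordinates paired in the `J'`-, `Z`- and `J`-part of `middle` have indices with sum `2`,
`3` and `4`, respectively; hence the shift by `3`. -/
theorem middle_mem_zeroPiece {n m : ℤ} {p q : Quad k J J'} (hp : p ∈ quadPiece k J J' n)
    (hq : q ∈ quadPiece k J J' m) : C.middle p q ∈ C.zeroPiece (n + m - 3) := by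
  rw [mem_quadPiece] at hp hq
  have h₁ : n + m ≠ 2 → -(p.1 • q.2.2.1) + C.cross p.2.1 q.2.1 - q.1 • p.2.2.1 = 0 := by
    intro h
    have e₁ : p.1 • q.2.2.1 = 0 := by
      by_cases hn : n = 0
      · rw [hq.2.2.1 (by omega), smul_zero]
      · rw [hp.1 hn, zero_smul]
    have e₂ : C.cross p.2.1 q.2.1 = 0 := by
      by_cases hn : n = 1
      · rw [hq.2.1 (by omega), map_zero]
      · rw [hp.2.1 hn, map_zero, LinearMap.zero_apply]
    have e₃ : q.1 • p.2.2.1 = 0 := by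
      by_cases hn : n = 2
      · rw [hq.1 (by omega), zero_smul]
      · rw [hp.2.2.1 hn, smul_zero]
    simp [e₁, e₂, e₃]
  have h₂ : n + m ≠ 3 → (p.1 * q.2.2.2 - C.T p.2.1 q.2.2.1) • zeta k J J' +
        (C.T q.2.1 p.2.2.1 - p.2.2.2 * q.1) • (xi k J J' - zeta k J J') +
        C.d p.2.1 q.2.2.1 + C.d q.2.1 p.2.2.1 = 0 := by
    intro h
    have e₁ : p.1 * q.2.2.2 = 0 := by
      by_cases hn : n = 0
      · rw [hq.2.2.2 (by omega), mul_zero]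
      · rw [hp.1 hn, zero_mul]
    have e₂ : C.T p.2.1 q.2.2.1 = 0 ∧ C.d p.2.1 q.2.2.1 = 0 := by
      by_cases hn : n = 1
      · rw [hq.2.2.1 (by omega), map_zero, d_zero_right]
        exact ⟨rfl, rfl⟩
      · rw [hp.2.1 hn, map_zero, LinearMap.zero_apply, d_zero_left]
        exact ⟨rfl, rfl⟩
    have e₃ : C.T q.2.1 p.2.2.1 = 0 ∧ C.d q.2.1 p.2.2.1 = 0 := by
      by_cases hn : n = 2
      · rw [hq.2.1 (by omega), map_zero, LinearMap.zero_apply, d_zero_left]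
        exact ⟨rfl, rfl⟩
      · rw [hp.2.2.1 hn, map_zero, d_zero_right]
        exact ⟨rfl, rfl⟩
    have e₄ : p.2.2.2 * q.1 = 0 := by
      by_cases hn : n = 3
      · rw [hq.1 (by omega), mul_zero]
      · rw [hp.2.2.2 hn, zero_mul]
    simp [e₁, e₂, e₃, e₄]
  have h₃ : n + m ≠ 4 → -(q.2.2.2 • p.2.1) + C.cross' p.2.2.1 q.2.2.1 - p.2.2.2 • q.2.1 = 0 := by
    intro h
    have e₁ : q.2.2.2 • p.2.1 = 0 := by
      by_cases hn : n = 1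
      · rw [hq.2.2.2 (by omega), zero_smul]
      · rw [hp.2.1 hn, smul_zero]
    have e₂ : C.cross' p.2.2.1 q.2.2.1 = 0 := by
      by_cases hn : n = 2
      · rw [hq.2.2.1 (by omega), map_zero]
      · rw [hp.2.2.1 hn, map_zero, LinearMap.zero_apply]
    have e₃ : p.2.2.2 • q.2.1 = 0 := by
      by_cases hn : n = 3
      · rw [hq.2.1 (by omega), smul_zero]
      · rw [hp.2.2.2 hn, zero_smul]
    simp [e₁, e₂, e₃]
  rw [middle_eq]
  by_cases hn₂ : n + m = 2
  · rw [h₂ (by omega), h₃ (by omega), hn₂, map_zero, add_zero, add_zero]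
    exact LinearMap.mem_range_self C.ad' _
  by_cases hn₃ : n + m = 3
  · rw [h₁ (by omega), h₃ (by omega), hn₃, map_zero, map_zero, add_zero, zero_add]
    exact add_mem (add_mem (add_mem (C.Z.smul_mem _ C.zeta_mem_Z)
      (C.Z.smul_mem _ (sub_mem C.xi_mem_Z C.zeta_mem_Z))) (C.d_mem_Z _ _)) (C.d_mem_Z _ _)
  by_cases hn₄ : n + m = 4
  · rw [h₁ (by omega), h₂ (by omega), hn₄, map_zero, add_zero, zero_add]
    exact LinearMap.mem_range_self C.ad _
  · rw [h₁ hn₂, h₂ hn₃, h₃ hn₄, map_zero, map_zero, add_zero, add_zero]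
    exact zero_mem _

theorem inNegTwo_mem_piece (t : k) : inNegTwo k J J' t ∈ C.piece (-2, -1) :=
  LinearMap.mem_range_self _ t

theorem inTwo_mem_piece (t : k) : inTwo k J J' t ∈ C.piece (2, 1) :=
  LinearMap.mem_range_self _ t

/-- The second degree runs from `-2` to `1` on `L₋₁` but from `-1` to `2` on `L₁`, so the coordinate
index is `j + 2` here and `j + 1` there. -/
theorem inNegOne_mem_piece {n j : ℤ} {p : Quad k J J'} (hp : p ∈ quadPiece k J J' n)
    (h : n = j + 2) : inNegOne k J J' p ∈ C.piece (-1, j) := by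
  obtain rfl : j = n - 2 := by omega
  unfold quadPiece at hp
  split at hp
  iterate 4
    obtain ⟨a, rfl⟩ := hp
    exact ⟨a, rfl⟩
  obtain rfl := (Submodule.mem_bot k).1 hp
  simp

theorem inOne_mem_piece {n j : ℤ} {p : Quad k J J'} (hp : p ∈ quadPiece k J J' n)
    (h : n = j + 1) : inOne k J J' p ∈ C.piece (1, j) := by
  obtain rfl : j = n - 1 := by omega
  unfold quadPiece at hp
  split at hp
  iterate 4
    obtain ⟨a, rfl⟩ := hp
    exact ⟨a, rfl⟩
  obtain rfl := (Submodule.mem_bot k).1 hp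
  simp

theorem inZero_mem_piece {j : ℤ} {φ : GlSum k J J'} (hφ : φ ∈ C.zeroPiece j) :
    inZero k J J' φ ∈ C.piece (0, j) := by
  unfold zeroPiece at hφ
  split at hφ
  · obtain ⟨a, rfl⟩ := hφ
    exact ⟨a, rfl⟩
  · exact ⟨φ, hφ, rfl⟩
  · obtain ⟨a, rfl⟩ := hφ
    exact ⟨a, rfl⟩
  · obtain rfl := (Submodule.mem_bot k).1 hφ
    simp

theorem mem_piece_cases {i j : ℤ} {x : Ambient k J J'} (hx : x ∈ C.piece (i, j)) :
    (i = -2 ∧ j = -1 ∧ ∃ t, x = inNegTwo k J J' t) ∨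
    (i = -1 ∧ ∃ p ∈ quadPiece k J J' (j + 2), x = inNegOne k J J' p) ∨
    (i = 0 ∧ ∃ φ ∈ C.zeroPiece j, x = inZero k J J' φ) ∨
    (i = 1 ∧ ∃ p ∈ quadPiece k J J' (j + 1), x = inOne k J J' p) ∨
    (i = 2 ∧ j = 1 ∧ ∃ t, x = inTwo k J J' t) ∨ x = 0 := by
  unfold piece at hx
  split at hx <;> rename_i heq <;> try obtain ⟨rfl, rfl⟩ := Prod.mk.inj heq
  · obtain ⟨t, rfl⟩ := hx
    exact .inl ⟨rfl, rfl, t, rfl⟩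
  iterate 4
    obtain ⟨a, rfl⟩ := hx
    exact .inr (.inl ⟨rfl, _, ⟨a, rfl⟩, rfl⟩)
  · obtain ⟨a, rfl⟩ := hx
    exact .inr (.inr (.inl ⟨rfl, _, ⟨a, rfl⟩, rfl⟩))
  · obtain ⟨a, ha, rfl⟩ := hx
    exact .inr (.inr (.inl ⟨rfl, _, ha, rfl⟩))
  · obtain ⟨a, rfl⟩ := hx
    exact .inr (.inr (.inl ⟨rfl, _, ⟨a, rfl⟩, rfl⟩))
  iterate 4
    obtain ⟨a, rfl⟩ := hx
    exact .inr (.inr (.inr (.inl ⟨rfl, _, ⟨a, rfl⟩, rfl⟩)))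
  · obtain ⟨t, rfl⟩ := hx
    exact .inr (.inr (.inr (.inr (.inl ⟨rfl, rfl, t, rfl⟩))))
  · exact .inr (.inr (.inr (.inr (.inr hx))))

end CubicNormPair

/-- Submodules which are separated by a family of linear maps are independent, and so are their
inverse images under an injective linear map. -/
theorem iSupIndep_comap_of_proj {R A L M N : Type*} [Semiring R] [AddCommMonoid L] [Module R L]
    [AddCommMonoid M] [Module R M] [AddCommMonoid N] [Module R N] {S : A → Submodule R M}
    (π : A → M →ₗ[R] N) (h₁ : ∀ a, ∀ x ∈ S a, π a x = 0 → x = 0)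
    (h₂ : ∀ a b, a ≠ b → ∀ x ∈ S b, π a x = 0) (f : L →ₗ[R] M) (hf : Function.Injective f) :
    iSupIndep fun a => (S a).comap f := by
  intro a
  rw [Submodule.disjoint_def]
  intro x hx hx'
  have hle : ⨆ b, ⨆ (_ : b ≠ a), (S b).comap f ≤ LinearMap.ker (π a ∘ₗ f) :=
    iSup₂_le fun b hb y hy => h₂ a b hb.symm (f y) hy
  exact hf ((h₁ a (f x) hx (hle hx')).trans (map_zero f).symm)

/-! ### The `ℤ²`-grading of `L` -/

namespace CubicNormPair

variable {k : Type u} {J : Type v} {J' : Type w} [CommRing k] [AddCommGroup J] [Module k J]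
  [AddCommGroup J'] [Module k J'] (C : CubicNormPair k J J')

-- Ordering the first degrees halves the number of cases; antisymmetry supplies the others.
set_option linter.unusedSimpArgs false in
theorem bracket_mem_piece_of_le {i j i' j' : ℤ} {x y : Ambient k J J'} (h : i ≤ i')
    (hx : x ∈ C.piece (i, j)) (hy : y ∈ C.piece (i', j')) :
    C.bracket x y ∈ C.piece (i + i', j + j') := by
  have hz : ∀ z, C.bracket z 0 = 0 := fun z => by simpa using C.bracket_smul_right 0 z 0
  have hz' : ∀ z, C.bracket 0 z = 0 := fun z => by simpa using C.bracket_smul_left 0 0 z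
  have f0 : ∀ p, C.form p 0 = 0 := fun p => by simp [form_eq]
  have f0' : ∀ p, C.form 0 p = 0 := fun p => by simp [form_eq]
  have m0 : ∀ p, C.middle p 0 = 0 := fun p => by
    simpa using C.middle_smul_right 0 p 0
  have m0' : ∀ p, C.middle 0 p = 0 := fun p => by
    simpa using C.middle_smul_left 0 0 p
  rcases C.mem_piece_cases hx with ⟨rfl, rfl, t, rfl⟩ | ⟨rfl, p, hp, rfl⟩ | ⟨rfl, φ, hφ, rfl⟩ |
    ⟨rfl, p, hp, rfl⟩ | ⟨rfl, rfl, t, rfl⟩ | rfl <;>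
  rcases C.mem_piece_cases hy with ⟨rfl, rfl, s, rfl⟩ | ⟨rfl, q, hq, rfl⟩ | ⟨rfl, ψ, hψ, rfl⟩ |
    ⟨rfl, q, hq, rfl⟩ | ⟨rfl, rfl, s, rfl⟩ | rfl <;>
  try omega
  all_goals try (rw [hz]; exact zero_mem _)
  all_goals try (rw [hz']; exact zero_mem _)
  · have e : C.bracket (inNegTwo k J J' t) (inNegTwo k J J' s) = 0 := by
      simp [bracket_eq, inNegTwo, inNegOne, inZero, inOne, inTwo, f0, f0', m0, m0']
    rw [e]
    exact zero_mem _
  · have e : C.bracket (inNegTwo k J J' t) (inNegOne k J J' q) = 0 := by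
      simp [bracket_eq, inNegTwo, inNegOne, inZero, inOne, inTwo, f0, f0', m0, m0']
    rw [e]
    exact zero_mem _
  · have e : C.bracket (inNegTwo k J J' t) (inZero k J J' ψ) = inNegTwo k J J' (-ψ.1 t) := by
      simp [bracket_eq, inNegTwo, inNegOne, inZero, inOne, inTwo, f0, f0', m0, m0']
    rw [e]
    -- Only the part of `L₀` in degree zero can act on `x` nontrivially.
    by_cases hj : j' = 0
    · subst hj
      exact C.inNegTwo_mem_piece _
    · rw [(C.zeroPiece_scalar hψ hj).1]
      simp
  · have e : C.bracket (inNegTwo k J J' t) (inOne k J J' q) = inNegOne k J J' (-(t • q)) := by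
      simp [bracket_eq, inNegTwo, inNegOne, inZero, inOne, inTwo, f0, f0', m0, m0']
    rw [e]
    exact C.inNegOne_mem_piece (neg_mem (Submodule.smul_mem _ t hq)) (by ring)
  · have e : C.bracket (inNegTwo k J J' t) (inTwo k J J' s) = inZero k J J' ((t * s) • xi k J J') := by
      simp [bracket_eq, inNegTwo, inNegOne, inZero, inOne, inTwo, f0, f0', m0, m0']
    rw [e]
    exact C.inZero_mem_piece (j := 0) (Submodule.smul_mem _ _ C.xi_mem_Z)
  · have e : C.bracket (inNegOne k J J' p) (inNegOne k J J' q) = inNegTwo k J J' (C.form p q) := by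
      simp [bracket_eq, inNegTwo, inNegOne, inZero, inOne, inTwo, f0, f0', m0, m0']
    rw [e]
    by_cases hj : j + j' = -1
    · rw [hj]
      exact C.inNegTwo_mem_piece _
    · rw [C.form_eq_zero_of_mem hp hq (by omega), map_zero]
      exact zero_mem _
  · have e : C.bracket (inNegOne k J J' p) (inZero k J J' ψ) = inNegOne k J J' (-ψ.2.1 p) := by
      simp [bracket_eq, inNegTwo, inNegOne, inZero, inOne, inTwo, f0, f0', m0, m0']
    rw [e]
    exact C.inNegOne_mem_piece (neg_mem (C.zeroPiece_neg_apply_mem hψ hp)) (by ring)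
  · have e : C.bracket (inNegOne k J J' p) (inOne k J J' q) = inZero k J J' (C.middle p q) := by
      simp [bracket_eq, inNegTwo, inNegOne, inZero, inOne, inTwo, f0, f0', m0, m0']
    rw [e]
    have hm := C.middle_mem_zeroPiece hp hq
    rw [show j + 2 + (j' + 1) - 3 = j + j' by ring] at hm
    exact C.inZero_mem_piece hm
  · have e : C.bracket (inNegOne k J J' p) (inTwo k J J' s) = inOne k J J' (-(s • p)) := by
      simp [bracket_eq, inNegTwo, inNegOne, inZero, inOne, inTwo, f0, f0', m0, m0']
    rw [e]
    exact C.inOne_mem_piece (neg_mem (Submodule.smul_mem _ s hp)) (by ring)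
  · have e : C.bracket (inZero k J J' φ) (inZero k J J' ψ) = inZero k J J' (φ * ψ - ψ * φ) := by
      simp [bracket_eq, inNegTwo, inNegOne, inZero, inOne, inTwo, f0, f0', m0, m0']
    rw [e]
    exact C.inZero_mem_piece (comm_mem_zeroPiece hφ hψ)
  · have e : C.bracket (inZero k J J' φ) (inOne k J J' q) = inOne k J J' (φ.2.2.1 q) := by
      simp [bracket_eq, inNegTwo, inNegOne, inZero, inOne, inTwo, f0, f0', m0, m0']
    rw [e]
    exact C.inOne_mem_piece (C.zeroPiece_pos_apply_mem hφ hq) (by ring)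
  · have e : C.bracket (inZero k J J' φ) (inTwo k J J' s) = inTwo k J J' (φ.2.2.2 s) := by
      simp [bracket_eq, inNegTwo, inNegOne, inZero, inOne, inTwo, f0, f0', m0, m0']
    rw [e]
    by_cases hj : j = 0
    · subst hj
      exact C.inTwo_mem_piece _
    · rw [(C.zeroPiece_scalar hφ hj).2]
      simp
  · have e : C.bracket (inOne k J J' p) (inOne k J J' q) = inTwo k J J' (C.form p q) := by
      simp [bracket_eq, inNegTwo, inNegOne, inZero, inOne, inTwo, f0, f0', m0, m0']
    rw [e]
    by_cases hj : j + j' = 1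
    · rw [hj]
      exact C.inTwo_mem_piece _
    · rw [C.form_eq_zero_of_mem hp hq (by omega), map_zero]
      exact zero_mem _
  · have e : C.bracket (inOne k J J' p) (inTwo k J J' s) = 0 := by
      simp [bracket_eq, inNegTwo, inNegOne, inZero, inOne, inTwo, f0, f0', m0, m0']
    rw [e]
    exact zero_mem _
  · have e : C.bracket (inTwo k J J' t) (inTwo k J J' s) = 0 := by
      simp [bracket_eq, inNegTwo, inNegOne, inZero, inOne, inTwo, f0, f0', m0, m0']
    rw [e]
    exact zero_mem _

theorem bracket_mem_piece {a b : ℤ × ℤ} {x y : Ambient k J J'} (hx : x ∈ C.piece a)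
    (hy : y ∈ C.piece b) : C.bracket x y ∈ C.piece (a + b) := by
  rcases le_total a.1 b.1 with h | h
  · exact C.bracket_mem_piece_of_le h hx hy
  · rw [C.bracket_swap y x, add_comm]
    exact neg_mem (C.bracket_mem_piece_of_le h hy hx)

theorem piece_le_lieModule (a : ℤ × ℤ) : C.piece a ≤ C.lieModule := by
  intro x hx
  have h0 : (0 : GlSum k J J') ∈ C.L₀ := zero_mem _
  rcases C.mem_piece_cases hx with ⟨-, -, t, rfl⟩ | ⟨-, p, -, rfl⟩ | ⟨-, φ, hφ, rfl⟩ |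
    ⟨-, p, -, rfl⟩ | ⟨-, -, t, rfl⟩ | rfl
  · exact ⟨trivial, trivial, h0, trivial, trivial⟩
  · exact ⟨trivial, trivial, h0, trivial, trivial⟩
  · exact ⟨trivial, trivial, zeroPiece_le_L₀ _ hφ, trivial, trivial⟩
  · exact ⟨trivial, trivial, h0, trivial, trivial⟩
  · exact ⟨trivial, trivial, h0, trivial, trivial⟩
  · exact zero_mem _

theorem lieModule_le_iSup_piece : C.lieModule ≤ ⨆ a, C.piece a := by
  have hle : ∀ a, ∀ x ∈ C.piece a, x ∈ ⨆ a, C.piece a := fun a x hx =>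
    Submodule.mem_iSup_of_mem a hx
  rintro ⟨α, ⟨l, b, b', m⟩, φ, ⟨n, c, c', r⟩, β⟩ hx
  obtain ⟨φ₁, h₁, φ₂, h₂, φ₃, h₃, hφ⟩ := exists_of_mem_L₀ hx.2.2.1
  have e : ((α, (l, b, b', m), φ, (n, c, c', r), β) : Ambient k J J') =
      inNegTwo k J J' α
      + (inNegOne k J J' (quad₁ k J J' l) + inNegOne k J J' (quad₂ k J J' b)
        + inNegOne k J J' (quad₃ k J J' b') + inNegOne k J J' (quad₄ k J J' m))
      + (inZero k J J' φ₁ + inZero k J J' φ₂ + inZero k J J' φ₃)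
      + (inOne k J J' (quad₁ k J J' n) + inOne k J J' (quad₂ k J J' c)
        + inOne k J J' (quad₃ k J J' c') + inOne k J J' (quad₄ k J J' r))
      + inTwo k J J' β := by
    dsimp only at hφ
    simp [inNegTwo, inNegOne, inZero, inOne, inTwo, quad₁, quad₂, quad₃, quad₄, hφ]
  rw [e]
  refine add_mem (add_mem (add_mem (add_mem ?_ (add_mem (add_mem (add_mem ?_ ?_) ?_) ?_))
    (add_mem (add_mem ?_ ?_) ?_)) (add_mem (add_mem (add_mem ?_ ?_) ?_) ?_)) ?_
  · exact hle _ _ (C.inNegTwo_mem_piece α)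
  · exact hle _ _ (C.inNegOne_mem_piece (n := 0) (j := -2)
      (LinearMap.mem_range_self (quad₁ k J J') l) rfl)
  · exact hle _ _ (C.inNegOne_mem_piece (n := 1) (j := -1)
      (LinearMap.mem_range_self (quad₂ k J J') b) rfl)
  · exact hle _ _ (C.inNegOne_mem_piece (n := 2) (j := 0)
      (LinearMap.mem_range_self (quad₃ k J J') b') rfl)
  · exact hle _ _ (C.inNegOne_mem_piece (n := 3) (j := 1)
      (LinearMap.mem_range_self (quad₄ k J J') m) rfl)
  · exact hle _ _ (C.inZero_mem_piece h₁)
  · exact hle _ _ (C.inZero_mem_piece h₂)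
  · exact hle _ _ (C.inZero_mem_piece h₃)
  · exact hle _ _ (C.inOne_mem_piece (n := 0) (j := -1)
      (LinearMap.mem_range_self (quad₁ k J J') n) rfl)
  · exact hle _ _ (C.inOne_mem_piece (n := 1) (j := 0)
      (LinearMap.mem_range_self (quad₂ k J J') c) rfl)
  · exact hle _ _ (C.inOne_mem_piece (n := 2) (j := 1)
      (LinearMap.mem_range_self (quad₃ k J J') c') rfl)
  · exact hle _ _ (C.inOne_mem_piece (n := 3) (j := 2)
      (LinearMap.mem_range_self (quad₄ k J J') r) rfl)
  · exact hle _ _ (C.inTwo_mem_piece β)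

/-- The projection of the module of quadruples onto one of its coordinate submodules. -/
def quadProj (k : Type u) (J : Type v) (J' : Type w) [CommRing k] [AddCommGroup J] [Module k J]
    [AddCommGroup J'] [Module k J'] (n : ℤ) : Quad k J J' →ₗ[k] Quad k J J' :=
  LinearMap.prodMap (if n = 0 then 1 else 0) (LinearMap.prodMap (if n = 1 then 1 else 0)
    (LinearMap.prodMap (if n = 2 then 1 else 0) (if n = 3 then 1 else 0)))

theorem quadProj_of_mem {n : ℤ} {p : Quad k J J'} (hp : p ∈ quadPiece k J J' n) :
    quadProj k J J' n p = p := by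
  rw [mem_quadPiece] at hp
  refine quad_ext ?_ ?_ ?_ ?_
  · by_cases h : n = 0
    · simp [quadProj, h]
    · simp [quadProj, h, hp.1 h]
  · by_cases h : n = 1
    · simp [quadProj, h]
    · simp [quadProj, h, hp.2.1 h]
  · by_cases h : n = 2
    · simp [quadProj, h]
    · simp [quadProj, h, hp.2.2.1 h]
  · by_cases h : n = 3
    · simp [quadProj, h]
    · simp [quadProj, h, hp.2.2.2 h]

theorem quadProj_of_mem_of_ne {n m : ℤ} (hnm : n ≠ m) {p : Quad k J J'}
    (hp : p ∈ quadPiece k J J' m) : quadProj k J J' n p = 0 := by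
  rw [mem_quadPiece] at hp
  refine quad_ext ?_ ?_ ?_ ?_
  · by_cases h : n = 0
    · simp [quadProj, h, hp.1 (by omega)]
    · simp [quadProj, h]
  · by_cases h : n = 1
    · simp [quadProj, h, hp.2.1 (by omega)]
    · simp [quadProj, h]
  · by_cases h : n = 2
    · simp [quadProj, h, hp.2.2.1 (by omega)]
    · simp [quadProj, h]
  · by_cases h : n = 3
    · simp [quadProj, h, hp.2.2.2 (by omega)]
    · simp [quadProj, h]

/-- The `J`-component of an element of `L₀`. -/
def up (k : Type u) (J : Type v) (J' : Type w) [CommRing k] [AddCommGroup J] [Module k J]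
    [AddCommGroup J'] [Module k J'] : GlSum k J J' →ₗ[k] J :=
  LinearMap.fst k _ _ ∘ₗ LinearMap.snd k _ _ ∘ₗ LinearMap.applyₗ (quad₁ k J J' 1) ∘ₗ
    LinearMap.fst k _ _ ∘ₗ LinearMap.snd k _ _

/-- The `J'`-component of an element of `L₀`. -/
def down (k : Type u) (J : Type v) (J' : Type w) [CommRing k] [AddCommGroup J] [Module k J]
    [AddCommGroup J'] [Module k J'] : GlSum k J J' →ₗ[k] J' :=
  -(LinearMap.fst k _ _ ∘ₗ LinearMap.snd k _ _ ∘ₗ LinearMap.snd k _ _ ∘ₗ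
    LinearMap.applyₗ (quad₄ k J J' 1) ∘ₗ LinearMap.fst k _ _ ∘ₗ LinearMap.snd k _ _)

/-- The element `a` is recovered from its action on `(1, 0, 0, 0)`, so `J` embeds into `M`. -/
theorem up_ad (a : J) : up k J J' (C.ad a) = a := by
  simp [up, quad₁]

theorem down_ad' (a : J') : down k J J' (C.ad' a) = a := by
  simp [down, quad₄]

/-- Only a shift up by one step moves `(1, 0, 0, 0)` into the `J`-coordinate. With `down_of_mem`,
this makes the sum `J' + Z + J` direct. -/
theorem up_of_mem {j : ℤ} {φ : GlSum k J J'} (hφ : φ ∈ C.zeroPiece j) (hj : j ≠ 1) :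
    up k J J' φ = 0 :=
  (mem_quadPiece.1 (C.zeroPiece_neg_apply_mem (n := 0) hφ
    (LinearMap.mem_range_self (quad₁ k J J') 1))).2.1 (by omega)

theorem down_of_mem {j : ℤ} {φ : GlSum k J J'} (hφ : φ ∈ C.zeroPiece j) (hj : j ≠ -1) :
    down k J J' φ = 0 :=
  neg_eq_zero.2 ((mem_quadPiece.1 (C.zeroPiece_neg_apply_mem (n := 3) hφ
    (LinearMap.mem_range_self (quad₄ k J J') 1))).2.2.1 (by omega))

/-- The projection of `L₀` onto its homogeneous component of degree `j`. -/
def zeroProj (j : ℤ) : GlSum k J J' →ₗ[k] GlSum k J J' :=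
  if j = -1 then C.ad' ∘ₗ down k J J'
  else if j = 0 then LinearMap.id - C.ad' ∘ₗ down k J J' - C.ad ∘ₗ up k J J'
  else if j = 1 then C.ad ∘ₗ up k J J' else 0

theorem ad_up_of_mem {φ : GlSum k J J'} (hφ : φ ∈ C.zeroPiece 1) :
    C.ad (up k J J' φ) = φ := by
  obtain ⟨a, rfl⟩ := hφ
  rw [up_ad]

theorem ad'_down_of_mem {φ : GlSum k J J'} (hφ : φ ∈ C.zeroPiece (-1)) :
    C.ad' (down k J J' φ) = φ := by
  obtain ⟨a, rfl⟩ := hφ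
  rw [down_ad']

theorem zeroPiece_eq_bot {j : ℤ} (h₁ : j ≠ -1) (h₂ : j ≠ 0) (h₃ : j ≠ 1) : C.zeroPiece j = ⊥ := by
  unfold zeroPiece
  split <;> simp_all

theorem zeroProj_of_mem {j : ℤ} {φ : GlSum k J J'} (hφ : φ ∈ C.zeroPiece j) :
    C.zeroProj j φ = φ := by
  unfold zeroProj
  split_ifs with h₁ h₂ h₃
  · subst h₁
    exact C.ad'_down_of_mem hφ
  · subst h₂
    simp [C.up_of_mem hφ, C.down_of_mem hφ]
  · subst h₃
    exact C.ad_up_of_mem hφ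
  · rw [C.zeroPiece_eq_bot h₁ h₂ h₃, Submodule.mem_bot] at hφ
    rw [hφ, map_zero]

theorem zeroProj_of_mem_of_ne {i j : ℤ} (hij : i ≠ j) {φ : GlSum k J J'}
    (hφ : φ ∈ C.zeroPiece j) : C.zeroProj i φ = 0 := by
  unfold zeroProj
  split_ifs with h₁ h₂ h₃
  · simp [C.down_of_mem hφ (by omega)]
  · subst h₂
    by_cases h₁ : j = -1
    · subst h₁
      simp [C.up_of_mem hφ, C.ad'_down_of_mem hφ]
    by_cases h₃ : j = 1
    · subst h₃
      simp [C.down_of_mem hφ, C.ad_up_of_mem hφ]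
    · rw [C.zeroPiece_eq_bot h₁ hij.symm h₃, Submodule.mem_bot] at hφ
      rw [hφ, map_zero]
  · simp [C.up_of_mem hφ (by omega)]
  · rfl

/-- The projection onto `L_{i,j}`. -/
def pieceProj (a : ℤ × ℤ) : Ambient k J J' →ₗ[k] Ambient k J J' :=
  LinearMap.prodMap (if a = (-2, -1) then 1 else 0)
    (LinearMap.prodMap (if a.1 = -1 then quadProj k J J' (a.2 + 2) else 0)
      (LinearMap.prodMap (if a.1 = 0 then C.zeroProj a.2 else 0)
        (LinearMap.prodMap (if a.1 = 1 then quadProj k J J' (a.2 + 1) else 0)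
          (if a = (2, 1) then 1 else 0))))

theorem pieceProj_of_mem {a : ℤ × ℤ} {x : Ambient k J J'} (hx : x ∈ C.piece a) :
    C.pieceProj a x = x := by
  obtain ⟨i, j⟩ := a
  rcases C.mem_piece_cases hx with ⟨rfl, rfl, t, rfl⟩ | ⟨rfl, p, hp, rfl⟩ | ⟨rfl, φ, hφ, rfl⟩ |
    ⟨rfl, p, hp, rfl⟩ | ⟨rfl, rfl, t, rfl⟩ | rfl
  · simp [pieceProj, inNegTwo]
  · simp [pieceProj, inNegOne, quadProj_of_mem hp]
  · simp [pieceProj, inZero, C.zeroProj_of_mem hφ]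
  · simp [pieceProj, inOne, quadProj_of_mem hp]
  · simp [pieceProj, inTwo]
  · rw [map_zero]

theorem pieceProj_of_mem_of_ne {a b : ℤ × ℤ} (hab : a ≠ b) {x : Ambient k J J'}
    (hx : x ∈ C.piece b) : C.pieceProj a x = 0 := by
  obtain ⟨i, j⟩ := b
  obtain ⟨i', j'⟩ := a
  rw [Ne, Prod.mk.injEq, not_and] at hab
  rcases C.mem_piece_cases hx with ⟨rfl, rfl, t, rfl⟩ | ⟨rfl, p, hp, rfl⟩ | ⟨rfl, φ, hφ, rfl⟩ |
    ⟨rfl, p, hp, rfl⟩ | ⟨rfl, rfl, t, rfl⟩ | rfl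
  · have h : ¬(i' = -2 ∧ j' = -1) := fun h => hab h.1 h.2
    simp [pieceProj, inNegTwo, h]
  · by_cases h : i' = -1
    · have := hab h
      simp [pieceProj, inNegOne, h, quadProj_of_mem_of_ne (n := j' + 2) (by omega) hp]
    · simp [pieceProj, inNegOne, h]
  · by_cases h : i' = 0
    · simp [pieceProj, inZero, h, C.zeroProj_of_mem_of_ne (hab h) hφ]
    · simp [pieceProj, inZero, h]
  · by_cases h : i' = 1
    · have := hab h
      simp [pieceProj, inOne, h, quadProj_of_mem_of_ne (n := j' + 1) (by omega) hp]
    · simp [pieceProj, inOne, h]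
  · have h : ¬(i' = 2 ∧ j' = 1) := fun h => hab h.1 h.2
    simp [pieceProj, inTwo, h]
  · rw [map_zero]

theorem iSupIndep_comap_piece :
    iSupIndep fun a => (C.piece a).comap C.lieModule.subtype := by
  refine iSupIndep_comap_of_proj (S := C.piece) (N := Ambient k J J') C.pieceProj ?_ ?_
    C.lieModule.subtype C.lieModule.injective_subtype
  · exact fun _ _ hx h => (C.pieceProj_of_mem hx).symm.trans h
  · exact fun _ _ hab _ hx => C.pieceProj_of_mem_of_ne hab hx

theorem iSup_comap_piece : ⨆ a, (C.piece a).comap C.lieModule.subtype = ⊤ := by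
  have h : C.lieModule ≤ (⨆ a, (C.piece a).comap C.lieModule.subtype).map
      C.lieModule.subtype := by
    refine C.lieModule_le_iSup_piece.trans (iSup_le fun a x hx => ?_)
    exact ⟨⟨x, C.piece_le_lieModule a hx⟩, Submodule.mem_iSup_of_mem a hx, rfl⟩
  rw [eq_top_iff]
  rintro x -
  obtain ⟨y, hy, hxy⟩ := h x.2
  rwa [← Subtype.ext hxy]

theorem piece_eq_bot_of_forall_ne {a : ℤ × ℤ} (h : a ∉ ({(-2, -1), (-1, -2), (-1, -1), (-1, 0),
    (-1, 1), (0, -1), (0, 0), (0, 1), (1, -1), (1, 0), (1, 1), (1, 2), (2, 1)} : Set (ℤ × ℤ))) :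
    C.piece a = ⊥ := by
  unfold piece
  split <;> first | rfl | exact absurd (by simp) h

/-- If `L_{i,j}` is the image of an injective linear map, it is isomorphic to the domain. -/
theorem nonempty_comap_piece_equiv {a : ℤ × ℤ} {N : Type*} [AddCommGroup N] [Module k N]
    (f : N →ₗ[k] Ambient k J J') (hf : Function.Injective f)
    (h : C.piece a = LinearMap.range f) :
    Nonempty ((C.piece a).comap C.lieModule.subtype ≃ₗ[k] N) :=
  ⟨(Submodule.comapSubtypeEquivOfLe (C.piece_le_lieModule a)).trans
    ((LinearEquiv.ofEq _ _ h).trans (LinearEquiv.ofInjective f hf).symm)⟩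

theorem inZero_comp_ad_injective : Function.Injective (inZero k J J' ∘ₗ C.ad) := by
  intro a b h
  have h' : C.ad a = C.ad b := congrArg (fun x : Ambient k J J' => x.2.2.1) h
  rw [← C.up_ad a, h', C.up_ad]

theorem inZero_comp_ad'_injective : Function.Injective (inZero k J J' ∘ₗ C.ad') := by
  intro a b h
  have h' : C.ad' a = C.ad' b := congrArg (fun x : Ambient k J J' => x.2.2.1) h
  rw [← C.down_ad' a, h', C.down_ad']

theorem nonempty_piece_equiv_ring {a : ℤ × ℤ} (h : a ∈ ({(-2, -1), (-1, -2), (-1, 1), (1, -1),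
    (1, 2), (2, 1)} : Set (ℤ × ℤ))) :
    Nonempty ((C.piece a).comap C.lieModule.subtype ≃ₗ[k] k) := by
  rcases h with rfl | rfl | rfl | rfl | rfl | rfl
  · exact C.nonempty_comap_piece_equiv _
      (fun a b h => congrArg (fun x : Ambient k J J' => x.1) h) rfl
  · exact C.nonempty_comap_piece_equiv _
      (fun a b h => congrArg (fun x : Ambient k J J' => x.2.1.1) h) rfl
  · exact C.nonempty_comap_piece_equiv _
      (fun a b h => congrArg (fun x : Ambient k J J' => x.2.1.2.2.2) h) rfl
  · exact C.nonempty_comap_piece_equiv _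
      (fun a b h => congrArg (fun x : Ambient k J J' => x.2.2.2.1.1) h) rfl
  · exact C.nonempty_comap_piece_equiv _
      (fun a b h => congrArg (fun x : Ambient k J J' => x.2.2.2.1.2.2.2) h) rfl
  · exact C.nonempty_comap_piece_equiv _
      (fun a b h => congrArg (fun x : Ambient k J J' => x.2.2.2.2) h) rfl

theorem nonempty_piece_equiv_left {a : ℤ × ℤ}
    (h : a ∈ ({(1, 0), (-1, -1), (0, 1)} : Set (ℤ × ℤ))) :
    Nonempty ((C.piece a).comap C.lieModule.subtype ≃ₗ[k] J) := by
  rcases h with rfl | rfl | rfl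
  · exact C.nonempty_comap_piece_equiv _
      (fun a b h => congrArg (fun x : Ambient k J J' => x.2.2.2.1.2.1) h) rfl
  · exact C.nonempty_comap_piece_equiv _
      (fun a b h => congrArg (fun x : Ambient k J J' => x.2.1.2.1) h) rfl
  · exact C.nonempty_comap_piece_equiv _ C.inZero_comp_ad_injective rfl

theorem nonempty_piece_equiv_right {a : ℤ × ℤ}
    (h : a ∈ ({(-1, 0), (1, 1), (0, -1)} : Set (ℤ × ℤ))) :
    Nonempty ((C.piece a).comap C.lieModule.subtype ≃ₗ[k] J') := by
  rcases h with rfl | rfl | rfl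
  · exact C.nonempty_comap_piece_equiv _
      (fun a b h => congrArg (fun x : Ambient k J J' => x.2.1.2.2.1) h) rfl
  · exact C.nonempty_comap_piece_equiv _
      (fun a b h => congrArg (fun x : Ambient k J J' => x.2.2.2.1.2.2.1) h) rfl
  · exact C.nonempty_comap_piece_equiv _ C.inZero_comp_ad'_injective rfl

end CubicNormPair

/-! ### The root system `G₂` in coordinates -/

section RootSystem

open RootPairing RootPairing.EmbeddedG2

variable {ι V V' : Type*} [AddCommGroup V] [Module ℝ V] [AddCommGroup V'] [Module ℝ V']
  (P : RootPairing ι ℝ V V') [P.EmbeddedG2]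

/-- The homomorphism `ω` from the root lattice to `ℤ²`, expressed in terms of coroots. -/
def latticeHom : P.rootSpan ℤ →+ ℤ × ℤ :=
  -- The coefficients are forced by the values at the simple roots: on `(γ, δ)` the coroot of `γ`
  -- takes the values `2, -1` and that of `δ` the values `-3, 2`.
  ((-P.coroot'In ℤ (long P)).prod
    (-P.coroot'In ℤ (short P) - 2 • P.coroot'In ℤ (long P))).toAddMonoidHom

theorem latticeHom_apply (a : P.rootSpan ℤ) : latticeHom P a = (-P.coroot'In ℤ (long P) a,
    -P.coroot'In ℤ (short P) a - 2 * P.coroot'In ℤ (long P) a) := by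
  simp [latticeHom]

/-- The image of a root under `ω`. -/
def rootCoord (i : ι) : ℤ × ℤ := latticeHom P (P.rootSpanMem ℤ i)

/-- Coordinates become expressions in Cartan integers, which are known for all roots of an embedded
`G₂`. -/
theorem rootCoord_eq (i : ι) : rootCoord P i =
    (-P.pairingIn ℤ i (long P), -P.pairingIn ℤ i (short P) - 2 * P.pairingIn ℤ i (long P)) := by
  rw [rootCoord, latticeHom_apply, coroot'In_rootSpanMem_eq_pairingIn,
    coroot'In_rootSpanMem_eq_pairingIn]

theorem rootCoord_long : rootCoord P (long P) = (-2, -1) := by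
  simp [rootCoord_eq]

theorem rootCoord_reflectionPerm_self (i : ι) :
    rootCoord P (P.reflectionPerm i i) = -rootCoord P i := by
  rw [rootCoord, rootSpanMem_reflectionPerm_self, map_neg, rootCoord]

theorem rootCoord_reflectionPerm (i j : ι) :
    rootCoord P (P.reflectionPerm i j) = rootCoord P j - P.pairingIn ℤ j i • rootCoord P i := by
  have h : P.rootSpanMem ℤ (P.reflectionPerm i j)
      = P.rootSpanMem ℤ j - P.pairingIn ℤ j i • P.rootSpanMem ℤ i := by
    ext
    simp [reflection_apply_root, ← P.algebraMap_pairingIn ℤ, Int.cast_smul_eq_zsmul]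
  rw [rootCoord, h, map_sub, map_zsmul, rootCoord, rootCoord]

omit [P.EmbeddedG2] in
theorem reflectionPerm_reflectionPerm_self_apply (i j : ι) :
    P.reflectionPerm (P.reflectionPerm i i) j = P.reflectionPerm i j := by
  apply P.root.injective
  simp [reflection_apply_root]

variable [Fintype ι]

theorem rootCoord_short : rootCoord P (short P) = (1, 0) := by
  simp [rootCoord_eq]

theorem rootCoord_shortAddLong : rootCoord P (shortAddLong P) = (-1, -1) := by
  simp [rootCoord_eq]

theorem rootCoord_twoShortAddLong : rootCoord P (twoShortAddLong P) = (0, -1) := by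
  simp [rootCoord_eq]

theorem rootCoord_threeShortAddLong : rootCoord P (threeShortAddLong P) = (1, -1) := by
  simp [rootCoord_eq]

theorem rootCoord_threeShortAddTwoLong : rootCoord P (threeShortAddTwoLong P) = (-1, -2) := by
  simp [rootCoord_eq]

theorem latticeHom_surjective : Function.Surjective (latticeHom P) := by
  rintro ⟨m, n⟩
  have h₁ : latticeHom P (P.rootSpanMem ℤ (long P)) = (-2, -1) := rootCoord_long P
  have h₂ : latticeHom P (P.rootSpanMem ℤ (short P)) = (1, 0) := rootCoord_short P
  -- The solution of `s (-2, -1) + t (1, 0) = (m, n)`; it is integral because the two vectors have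
  -- determinant `1`.
  refine ⟨(-n) • P.rootSpanMem ℤ (long P) + (m - 2 * n) • P.rootSpanMem ℤ (short P), ?_⟩
  rw [map_add, map_zsmul, map_zsmul, h₁, h₂]
  ext <;> simp
  ring

/-- The coordinates of the long roots. -/
def longCoords : Set (ℤ × ℤ) := {(-2, -1), (-1, -2), (-1, 1), (1, -1), (1, 2), (2, 1)}

/-- The coordinates of the short roots in the orbit of `δ`. -/
def shortCoords : Set (ℤ × ℤ) := {(1, 0), (-1, -1), (0, 1)}

/-- The coordinates of the remaining short roots. -/
def shortCoords' : Set (ℤ × ℤ) := {(-1, 0), (1, 1), (0, -1)}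

theorem disjoint_shortCoords : Disjoint shortCoords shortCoords' := by
  simp [shortCoords, shortCoords']

theorem longCoords_subset_range : longCoords ⊆ Set.range (rootCoord P) := by
  rintro _ (rfl | rfl | rfl | rfl | rfl | rfl)
  · exact ⟨_, rootCoord_long P⟩
  · exact ⟨_, rootCoord_threeShortAddTwoLong P⟩
  · exact ⟨_, (rootCoord_reflectionPerm_self P _).trans
      (congrArg Neg.neg (rootCoord_threeShortAddLong P))⟩
  · exact ⟨_, rootCoord_threeShortAddLong P⟩
  · exact ⟨_, (rootCoord_reflectionPerm_self P _).trans
      (congrArg Neg.neg (rootCoord_threeShortAddTwoLong P))⟩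
  · exact ⟨_, (rootCoord_reflectionPerm_self P _).trans
      (congrArg Neg.neg (rootCoord_long P))⟩

theorem shortCoords_subset_range : shortCoords ⊆ Set.range (rootCoord P) := by
  rintro _ (rfl | rfl | rfl)
  · exact ⟨_, rootCoord_short P⟩
  · exact ⟨_, rootCoord_shortAddLong P⟩
  · exact ⟨_, (rootCoord_reflectionPerm_self P _).trans
      (congrArg Neg.neg (rootCoord_twoShortAddLong P))⟩

theorem shortCoords'_subset_range : shortCoords' ⊆ Set.range (rootCoord P) := by
  rintro _ (rfl | rfl | rfl)
  · exact ⟨_, (rootCoord_reflectionPerm_self P _).trans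
      (congrArg Neg.neg (rootCoord_short P))⟩
  · exact ⟨_, (rootCoord_reflectionPerm_self P _).trans
      (congrArg Neg.neg (rootCoord_shortAddLong P))⟩
  · exact ⟨_, rootCoord_twoShortAddLong P⟩

theorem rootForm_short_lt_long :
    P.RootForm (shortRoot P) (shortRoot P) < P.RootForm (longRoot P) (longRoot P) := by
  have h := long_eq_three_mul_short P.toInvariantForm
  have h₀ := P.toInvariantForm.ne_zero (short P)
  have h₁ := (P.rootForm_self_sum_of_squares (shortRoot P)).nonneg
  simp only [toInvariantForm_form] at h h₀
  have := lt_of_le_of_ne h₁ h₀.symm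
  linarith

variable [P.IsIrreducible]

theorem index_cases (i : ι) : ∃ j, (j = long P ∨ j = short P ∨ j = shortAddLong P ∨
    j = twoShortAddLong P ∨ j = threeShortAddLong P ∨ j = threeShortAddTwoLong P) ∧
    (i = j ∨ i = P.reflectionPerm j j) := by
  have key : ∀ {j}, P.root i = -P.root j → i = P.reflectionPerm j j := fun {j} h => by
    apply P.root.injective
    simp [h]
  have h := mem_allRoots P i
  simp only [List.mem_cons, List.not_mem_nil, or_false] at h
  rcases h with h | h | h | h | h | h | h | h | h | h | h | h
  · exact ⟨_, by simp, .inl (P.root.injective h)⟩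
  · exact ⟨_, by simp, .inr (key h)⟩
  · exact ⟨_, by simp, .inl (P.root.injective h)⟩
  · exact ⟨_, by simp, .inr (key h)⟩
  · exact ⟨_, by simp, .inl (P.root.injective h)⟩
  · exact ⟨_, by simp, .inr (key h)⟩
  · exact ⟨_, by simp, .inl (P.root.injective h)⟩
  · exact ⟨_, by simp, .inr (key h)⟩
  · exact ⟨_, by simp, .inl (P.root.injective h)⟩
  · exact ⟨_, by simp, .inr (key h)⟩
  · exact ⟨_, by simp, .inl (P.root.injective h)⟩
  · exact ⟨_, by simp, .inr (key h)⟩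

theorem rootSpan_eq : P.rootSpan ℤ = Submodule.span ℤ {longRoot P, shortRoot P} := by
  apply le_antisymm
  · rw [Submodule.span_le]
    rintro _ ⟨i, rfl⟩
    exact mem_span_of_mem_allRoots P (mem_allRoots P i)
  · rw [Submodule.span_le]
    rintro _ (rfl | rfl)
    · exact Submodule.subset_span ⟨_, rfl⟩
    · exact Submodule.subset_span ⟨_, rfl⟩

theorem exists_eq_zsmul_add (a : P.rootSpan ℤ) : ∃ m n : ℤ,
    a = m • P.rootSpanMem ℤ (long P) + n • P.rootSpanMem ℤ (short P) := by
  obtain ⟨m, n, h⟩ := Submodule.mem_span_pair.1 ((rootSpan_eq P).le a.2)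
  exact ⟨m, n, Subtype.ext h.symm⟩

theorem latticeHom_injective : Function.Injective (latticeHom P) := by
  rw [injective_iff_map_eq_zero]
  intro a ha
  obtain ⟨m, n, rfl⟩ := exists_eq_zsmul_add P a
  have h₁ : latticeHom P (P.rootSpanMem ℤ (long P)) = (-2, -1) := rootCoord_long P
  have h₂ : latticeHom P (P.rootSpanMem ℤ (short P)) = (1, 0) := rootCoord_short P
  rw [map_add, map_zsmul, map_zsmul, h₁, h₂] at ha
  simp at ha
  obtain ⟨h, rfl⟩ := ha
  obtain rfl : n = 0 := by omega
  simp

theorem rootCoord_injective : Function.Injective (rootCoord P) := by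
  intro i j h
  exact P.root.injective (congrArg Subtype.val (latticeHom_injective P h))

/-- Recording position and length together links the metric notion of a long root to coordinates. -/
theorem rootCoord_mem (i : ι) :
    (rootCoord P i ∈ longCoords ∧ P.RootForm (P.root i) (P.root i)
      = P.RootForm (longRoot P) (longRoot P)) ∨
    ((rootCoord P i ∈ shortCoords ∨ rootCoord P i ∈ shortCoords') ∧
      P.RootForm (P.root i) (P.root i) = P.RootForm (shortRoot P) (shortRoot P)) := by
  obtain ⟨j, hj, hi⟩ := index_cases P i
  have hneg : P.RootForm (P.root (P.reflectionPerm j j)) (P.root (P.reflectionPerm j j))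
      = P.RootForm (P.root j) (P.root j) := by simp
  have e₁ := shortAddLongRoot_shortRoot P.toInvariantForm
  have e₂ := twoShortAddLongRoot_shortRoot P.toInvariantForm
  have e₃ := threeShortAddLongRoot_longRoot P.toInvariantForm
  have e₄ := threeShortAddTwoLongRoot_longRoot P.toInvariantForm
  simp only [toInvariantForm_form] at e₁ e₂ e₃ e₄
  rcases hj with rfl | rfl | rfl | rfl | rfl | rfl <;> rcases hi with rfl | rfl <;>
    simp [rootCoord_reflectionPerm_self, rootCoord_long, rootCoord_short, rootCoord_shortAddLong,
      rootCoord_twoShortAddLong, rootCoord_threeShortAddLong, rootCoord_threeShortAddTwoLong,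
      longCoords, shortCoords, shortCoords', e₁, e₂, e₃, e₄]

theorem isLong_iff (i : ι) : IsLong P i ↔ rootCoord P i ∈ longCoords := by
  have hlt := rootForm_short_lt_long P
  constructor
  · intro h
    rcases rootCoord_mem P i with h' | h'
    · exact h'.1
    · have := h (long P)
      rw [h'.2] at this
      exact absurd hlt (not_lt.2 this)
  · intro h j
    rcases rootCoord_mem P i with hi | hi
    · rw [hi.2]
      rcases rootCoord_mem P j with hj | hj
      · exact hj.2.le
      · exact hj.2.le.trans hlt.le
    · exfalso
      have := hi.1
      generalize rootCoord P i = x at this h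
      rcases h with rfl | rfl | rfl | rfl | rfl | rfl <;> simp [shortCoords, shortCoords'] at this

theorem not_isLong_iff (i : ι) :
    ¬IsLong P i ↔ rootCoord P i ∈ shortCoords ∨ rootCoord P i ∈ shortCoords' := by
  rw [isLong_iff]
  constructor
  · intro h
    exact ((rootCoord_mem P i).resolve_left fun h' => h h'.1).1
  · intro h h'
    generalize rootCoord P i = x at h h'
    rcases h' with rfl | rfl | rfl | rfl | rfl | rfl <;> simp [shortCoords, shortCoords'] at h

/-- A reflection in a long root changes a root by a multiple of that long root, whose coordinate sum
is divisible by `3`; the coordinate sum is `1` modulo `3` on `shortCoords` and `2` on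
`shortCoords'`. -/
theorem rootCoord_reflectionPerm_mem_iff {i : ι} (hi : IsLong P i) (j : ι) :
    rootCoord P (P.reflectionPerm i j) ∈ shortCoords ↔ rootCoord P j ∈ shortCoords := by
  have h₁ : ∀ j, rootCoord P (P.reflectionPerm (long P) j) ∈ shortCoords
      ↔ rootCoord P j ∈ shortCoords := by
    intro j
    rw [rootCoord_reflectionPerm, rootCoord_long, rootCoord_eq]
    simp [shortCoords]
    omega
  have h₂ : ∀ j, rootCoord P (P.reflectionPerm (threeShortAddLong P) j) ∈ shortCoords
      ↔ rootCoord P j ∈ shortCoords := by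
    intro j
    rw [rootCoord_reflectionPerm, rootCoord_threeShortAddLong, rootCoord_eq]
    simp [shortCoords, pairingIn_threeShortAddLong_right]
    omega
  have h₃ : ∀ j, rootCoord P (P.reflectionPerm (threeShortAddTwoLong P) j) ∈ shortCoords
      ↔ rootCoord P j ∈ shortCoords := by
    intro j
    rw [rootCoord_reflectionPerm, rootCoord_threeShortAddTwoLong, rootCoord_eq]
    simp [shortCoords, pairingIn_threeShortAddTwoLong_right]
    omega
  rw [isLong_iff] at hi
  -- Opposite roots have the same reflection, so only `γ`, `γ + 3δ` and `2γ + 3δ` have to be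
  -- treated.
  obtain ⟨l, hl, hil⟩ := index_cases P i
  have hil' : P.reflectionPerm i j = P.reflectionPerm l j := by
    rcases hil with rfl | rfl
    · rfl
    · exact reflectionPerm_reflectionPerm_self_apply P l j
  rw [hil']
  rcases hl with rfl | rfl | rfl | rfl | rfl | rfl
  · exact h₁ j
  · rcases hil with rfl | rfl <;>
      simp [rootCoord_reflectionPerm_self, rootCoord_short, longCoords] at hi
  · rcases hil with rfl | rfl <;>
      simp [rootCoord_reflectionPerm_self, rootCoord_shortAddLong, longCoords] at hi
  · rcases hil with rfl | rfl <;>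
      simp [rootCoord_reflectionPerm_self, rootCoord_twoShortAddLong, longCoords] at hi
  · exact h₂ j
  · exact h₃ j

theorem orbit_longWeyl_short :
    MulAction.orbit (longWeyl P) (short P) = rootCoord P ⁻¹' shortCoords := by
  apply Set.Subset.antisymm
  · rintro _ ⟨⟨g, hg⟩, rfl⟩
    have key : ∀ j, rootCoord P (g j) ∈ shortCoords ↔ rootCoord P j ∈ shortCoords := by
      refine Subgroup.closure_induction
        (p := fun g _ => ∀ j, rootCoord P (g j) ∈ shortCoords ↔ rootCoord P j ∈ shortCoords)
        ?_ ?_ ?_ ?_ hg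
      · rintro _ ⟨i, hi, rfl⟩ j
        exact rootCoord_reflectionPerm_mem_iff P hi j
      · intro j
        rfl
      · intro g h _ _ hg hh j
        rw [Equiv.Perm.mul_apply, hg, hh]
      · intro g _ hg j
        rw [← hg, ← Equiv.Perm.mul_apply, mul_inv_cancel, Equiv.Perm.one_apply]
    refine (key _).2 ?_
    simp [rootCoord_short, shortCoords]
  · intro i hi
    -- Conversely, one reflection suffices: `γ` sends `δ` to the root at `(-1, -1)`, and `γ + 3δ`
    -- sends it to the root at `(0, 1)`.
    have hs : ∀ {l}, IsLong P l → rootCoord P (P.reflectionPerm l (short P)) = rootCoord P i →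
        i ∈ MulAction.orbit (longWeyl P) (short P) := fun {l} hl h =>
      ⟨⟨P.reflectionPerm l, Subgroup.subset_closure ⟨l, hl, rfl⟩⟩, rootCoord_injective P h⟩
    rcases hi with h | h | h
    · have : i = short P := rootCoord_injective P (h.trans (rootCoord_short P).symm)
      rw [this]
      exact MulAction.mem_orbit_self _
    · refine hs (l := long P) ((isLong_iff P _).2 (by simp [rootCoord_long, longCoords])) ?_
      rw [h, rootCoord_reflectionPerm, rootCoord_long, rootCoord_short]
      simp
    · refine hs (l := threeShortAddLong P)
        ((isLong_iff P _).2 (by simp [rootCoord_threeShortAddLong, longCoords])) ?_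
      rw [h, rootCoord_reflectionPerm, rootCoord_threeShortAddLong, rootCoord_short]
      simp

theorem ncard_rootCoord_preimage_shortCoords : (rootCoord P ⁻¹' shortCoords).ncard = 3 := by
  rw [Set.ncard_preimage_of_injective_subset_range (rootCoord_injective P)
    (shortCoords_subset_range P), shortCoords, Set.ncard_eq_three]
  exact ⟨_, _, _, by simp, by simp, by simp, rfl⟩

theorem ncard_rootCoord_preimage_shortCoords' : (rootCoord P ⁻¹' shortCoords').ncard = 3 := by
  rw [Set.ncard_preimage_of_injective_subset_range (rootCoord_injective P)
    (shortCoords'_subset_range P), shortCoords', Set.ncard_eq_three]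
  exact ⟨_, _, _, by simp, by simp, by simp, rfl⟩

theorem latticeHom_notMem (a : P.rootSpan ℤ) (h₀ : a ≠ 0) (h : ∀ i, a ≠ P.rootSpanMem ℤ i) :
    latticeHom P a ∉ ({(-2, -1), (-1, -2), (-1, -1), (-1, 0), (-1, 1), (0, -1), (0, 0), (0, 1),
      (1, -1), (1, 0), (1, 1), (1, 2), (2, 1)} : Set (ℤ × ℤ)) := by
  intro ha
  have key : latticeHom P a ∉ Set.range (rootCoord P) := by
    rintro ⟨i, hi⟩
    exact h i (latticeHom_injective P hi.symm)
  have h₁ := fun h' => key (longCoords_subset_range P h')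
  have h₂ := fun h' => key (shortCoords_subset_range P h')
  have h₃ := fun h' => key (shortCoords'_subset_range P h')
  have h₄ : latticeHom P a ≠ (0, 0) := fun h' =>
    h₀ (latticeHom_injective P (h'.trans (map_zero (latticeHom P)).symm))
  simp only [longCoords, shortCoords, shortCoords', Set.mem_insert_iff,
    Set.mem_singleton_iff] at h₁ h₂ h₃ ha
  tauto

end RootSystem

end G2Lie

end

/-! ### Transport of the grading to the root lattice -/

theorem theorem4 {k : Type u} {J : Type v} {J' : Type w} [CommRing k]
    [AddCommGroup J] [Module k J] [AddCommGroup J'] [Module k J']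
    (C : G2Lie.CubicNormPair k J J')
    {ι V V' : Type*} [Fintype ι] [AddCommGroup V] [Module ℝ V] [AddCommGroup V'] [Module ℝ V']
    (P : RootPairing ι ℝ V V') [P.IsG2]
    (γ δ : ι) (hγδ : P.pairingIn ℤ γ δ = -3) :
    ∃ (L : Type max u v w) (_ : LieRing L) (_ : LieAlgebra k L) (e : L ≃ₗ[k] C.lieModule),
      (∀ l m : L, (e ⁅l, m⁆ : G2Lie.Ambient k J J') = C.bracket (e l) (e m)) ∧
      ∃ S : P.rootSpan ℤ → Submodule k L,
        (∃ ω : P.rootSpan ℤ →+ ℤ × ℤ,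
          ω (P.rootSpanMem ℤ γ) = (-2, -1) ∧ ω (P.rootSpanMem ℤ δ) = (1, 0) ∧
          ∀ a, S a = (C.piece (ω a)).comap (C.lieModule.subtype ∘ₗ e.toLinearMap)) ∧
        G2Lie.IsRootGrading P S ∧
        (∀ i, G2Lie.IsLong P i → Nonempty (S (P.rootSpanMem ℤ i) ≃ₗ[k] k)) ∧
        ∃ A B : Set ι,
          A = MulAction.orbit (G2Lie.longWeyl P) δ ∧
          Disjoint A B ∧ A ∪ B = {i | ¬ G2Lie.IsLong P i} ∧
          A.ncard = 3 ∧ B.ncard = 3 ∧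
          (∀ i ∈ A, Nonempty (S (P.rootSpanMem ℤ i) ≃ₗ[k] J)) ∧
          (∀ i ∈ B, Nonempty (S (P.rootSpanMem ℤ i) ≃ₗ[k] J')) := by
  -- The Cartan integer `-3` identifies `γ` as the long and `δ` as the short root of the pair.
  let : P.EmbeddedG2 := { long := γ, short := δ, pairingIn_long_short := hγδ }
  let := C.lieRing
  let := C.lieAlgebra
  refine ⟨C.lieModule, C.lieRing, C.lieAlgebra, LinearEquiv.refl k _, fun _ _ => rfl,
    fun a => (C.piece (G2Lie.latticeHom P a)).comap C.lieModule.subtype,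
    ⟨G2Lie.latticeHom P, G2Lie.rootCoord_long P, G2Lie.rootCoord_short P, fun _ => rfl⟩,
    { iSupIndep := C.iSupIndep_comap_piece.comp (G2Lie.latticeHom_injective P)
      iSup_eq_top := ?_
      lie_mem := ?_
      eq_bot := ?_ },
    fun i hi => C.nonempty_piece_equiv_ring ((G2Lie.isLong_iff P i).1 hi),
    G2Lie.rootCoord P ⁻¹' G2Lie.shortCoords, G2Lie.rootCoord P ⁻¹' G2Lie.shortCoords',
    (G2Lie.orbit_longWeyl_short P).symm, G2Lie.disjoint_shortCoords.preimage _, ?_,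
    G2Lie.ncard_rootCoord_preimage_shortCoords P, G2Lie.ncard_rootCoord_preimage_shortCoords' P,
    fun i hi => C.nonempty_piece_equiv_left hi, fun i hi => C.nonempty_piece_equiv_right hi⟩
  -- Independence used only that `ω` is injective; for the supremum no degree may be missed, which
  -- is surjectivity.
  · exact ((G2Lie.latticeHom_surjective P).iSup_comp
      fun a => (C.piece a).comap C.lieModule.subtype).trans C.iSup_comap_piece
  · intro a b x y hx hy
    have h := C.bracket_mem_piece hx hy
    rw [← map_add] at h
    exact h
  · intro a h₀ h
    rw [C.piece_eq_bot_of_forall_ne (G2Lie.latticeHom_notMem P a h₀ h)]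
    exact Submodule.ker_subtype _
  · ext i
    exact (G2Lie.not_isLong_iff P i).symm
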